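/- Let $\Omega$ be a closed smooth manifold of dimension $m+k$, $k>0$, and let $M\subset\Omega$ be a closed smooth embedded submanifold of dimension $m$. Let $\tau\colon\Omega\to\Omega$ be a smooth involution with $\tau(M)=M$, and let $\Omega^\tau$ denote its fixed point set. Assume that $\Omega^\tau$ is a smooth submanifold of $\Omega$ of codimension $n$ and that $M\cap\Omega^\tau$ is a smooth submanifold of $M$ of codimension $r$ (in $M$). Let $F\colon\Omega\to\mathbb R$ be an embedded equivariant Morse function, that is, a smooth function with $F\circ\tau=F$ such that $F$ is a Morse function on $\Omega$, the restriction $f=F|_M$ is a Morse function on $M$, and no critical point of $F$ lies on $M$. (A smooth function is Morse if its second derivative is nondegenerate at each of its critical points.) **Theorem (Equivariant Embedded Morse Lemma).** Suppose $u_0\in M\cap\Omega^\tau$ is a critical point of $f$. Then $r\le m$, $r\le n$, and, with $s$ defined by $(n-r)+s=k$, one has $s\ge 1$. Moreover there are integers $0\le a\le r$, $0\le b\le m-r$, a $\tau$-invariant open neighbourhood $U$ of $u_0$ in $\Omega$, and smooth local coordinates $$x_1,\dots,x_r,\;y_1,\dots,y_{m-r},\;v_1,\dots,v_{n-r},\;w_1,\dots,w_s$$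 on $U$, all vanishing at $u_0$, such that on $U$: 1. $\tau$ is linear: $\tau(x,y,v,w)=(-x,y,-v,w)$, i.e. $\tau$ changes the sign of all $x_i$ and $v_i$ and preserves all $y_i$ and $w_i$; 2. $M$ is given by $\{v_1=\dots=v_{n-r}=w_1=\dots=w_s=0\}$; 3. $\Omega^\tau$ is given by $\{x_1=\dots=x_r=v_1=\dots=v_{n-r}=0\}$; 4. $F=F(u_0)-x_1^2-\dots-x_a^2+x_{a+1}^2+\dots+x_r^2-y_1^2-\dots-y_b^2+y_{b+1}^2+\dots+y_{m-r}^2+w_1.$ -/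

import Mathlib

open scoped Manifold ContDiff
open Set Function

/-- `z` is a system of smooth local coordinates on the open set `U` of the `d`-dimensional
manifold `X`: up to a labelling `c` of the `d` coordinates by `ι`, it is a chart with domain `U`
belonging to the maximal smooth atlas of `X`. -/
def IsLocalCoordinates (d : ℕ) {X : Type*} [TopologicalSpace X]
    [ChartedSpace (EuclideanSpace ℝ (Fin d)) X] {ι : Type*}
    (U : Set X) (z : ι → X → ℝ) : Prop :=
  ∃ e ∈ IsManifold.maximalAtlas (𝓡 d) ∞ X, e.source = U ∧
    ∃ c : ι ≃ Fin d, ∀ u ∈ U, ∀ i, z i u = e u (c i)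

/-- `S` is a smooth (embedded) submanifold of codimension `c` of the `d`-dimensional manifold `X`:
near each of its points it is given, in suitable local coordinates of `X`, by the vanishing of
`c` of the coordinates. -/
def IsSubmanifoldOfCodim (d c : ℕ) {X : Type*} [TopologicalSpace X]
    [ChartedSpace (EuclideanSpace ℝ (Fin d)) X] (S : Set X) : Prop :=
  ∀ p ∈ S, ∃ U : Set X, p ∈ U ∧ ∃ z : Fin d → X → ℝ, IsLocalCoordinates d U z ∧
    ∃ J : Finset (Fin d), J.card = c ∧ ∀ u ∈ U, u ∈ S ↔ ∀ i ∈ J, z i u = 0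

/-- `u` is a critical point of the (smooth) function `f`. -/
def IsCriticalPoint (d : ℕ) {X : Type*} [TopologicalSpace X]
    [ChartedSpace (EuclideanSpace ℝ (Fin d)) X] (f : X → ℝ) (u : X) : Prop :=
  mfderiv (𝓡 d) 𝓘(ℝ, ℝ) f u = 0

/-- The matrix of second partial derivatives of `f` at `u`, in the preferred chart at `u`. -/
noncomputable def hessianMatrix (d : ℕ) {X : Type*} [TopologicalSpace X]
    [ChartedSpace (EuclideanSpace ℝ (Fin d)) X] (f : X → ℝ) (u : X) :
    Matrix (Fin d) (Fin d) ℝ :=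
  let φ := chartAt (EuclideanSpace ℝ (Fin d)) u
  Matrix.of fun i j =>
    fderiv ℝ (fun z => fderiv ℝ (f ∘ φ.symm) z (EuclideanSpace.single i 1)) (φ u)
      (EuclideanSpace.single j 1)

/-- `f` is a Morse function on the `d`-dimensional manifold `X`: it is smooth and the determinant
of its second derivative is nonzero at every critical point. -/
structure IsMorse (d : ℕ) {X : Type*} [TopologicalSpace X]
    [ChartedSpace (EuclideanSpace ℝ (Fin d)) X] (f : X → ℝ) : Prop where
  smooth : ContMDiff (𝓡 d) 𝓘(ℝ, ℝ) ∞ f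
  nondegenerate : ∀ u, IsCriticalPoint d f u → (hessianMatrix d f u).det ≠ 0

/-- `F : Ω → ℝ` is an embedded equivariant Morse function, for the submanifold `M` of `Ω`
(embedded by `emb`) and the involution `τ` of `Ω`. -/
structure IsEmbeddedEquivariantMorse (m d : ℕ) {M Ω : Type*}
    [TopologicalSpace M] [ChartedSpace (EuclideanSpace ℝ (Fin m)) M]
    [TopologicalSpace Ω] [ChartedSpace (EuclideanSpace ℝ (Fin d)) Ω]
    (emb : M → Ω) (τ : Ω → Ω) (F : Ω → ℝ) : Prop where
  invariant : ∀ u, F (τ u) = F u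
  morse : IsMorse d F
  morse_restrict : IsMorse m (F ∘ emb)
  not_critical : ∀ p : M, ¬ IsCriticalPoint d F (emb p)

/-! Because `emb` is an immersion, charts identify `Ω` near `u₀` with `V × W` so that `M` is `V ×
0`. The differential of `τ` at `u₀` preserves `V`, so it is block triangular; let `T₁`, `T₂` be its
diagonal blocks, which are again involutions. Averaging each component of `z` with its transform,
`(z + T τ z) / 2` with `T` the matching block, gives maps `P` and `Q` with `P ∘ τ = T₁ ∘ P`, `Q ∘ τ
= T₂ ∘ Q` and `Q = 0` on `V` (`exists_linearizing_coordinates`). These linearize `τ` and `M`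
together.

Read in the coordinate `P`, the function `F|_M` is `T₁`-invariant with a nondegenerate critical
point. The equivariant Morse lemma (`exists_equivariant_morse_coordinates`) turns it into a constant
plus `A (H v) (H v)`, with `H` commuting with `T₁`. Its engine is uniqueness of square roots near
the identity: with `F = F(u₀) + B z z z` and `R z = A⁻¹ B z`, the root `C z` of `R z` must be
self-adjoint and equivariant, since its adjoint and its conjugate are roots of the matching
operators. One takes `H z = C z z`. The eigenspaces of `T₁` are `A`-orthogonal, and Sylvester's
theorem on each of them produces the `x` and `y` squares.

No Morse lemma with parameters is needed off `M`. The remainder `R = F - F(u₀) - A (H P) (H P)` is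
`τ`-invariant, vanishes on `M`, and has differential `dF ≠ 0` at `u₀`. Since `dF` kills `V` and is
`T₂`-invariant on `W`, it can be a linear coordinate on the `+1` eigenspace of `T₂`; this forces `s
≥ 1`, and `R` itself then serves as `w₁` (`exists_local_normal_form`).

The numbers of sign-changing coordinates are identified with the given codimensions by
`card_le_card_of_isLocalCoordinates`: the transition differential carries one tangent space
injectively into the other. -/

open Filter Topology MeasureTheory

/-! ### Calculus of smooth germs: Hadamard's lemma and the inverse function theorem -/

section Calculus

variable {E F G : Type*} [NormedAddCommGroup E] [NormedSpace ℝ E]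
  [NormedAddCommGroup F] [NormedSpace ℝ F] [NormedAddCommGroup G] [NormedSpace ℝ G]

/-- `f` is smooth on a neighbourhood of `x`. -/
def SmoothNear (f : E → F) (x : E) : Prop := ∀ᶠ z in 𝓝 x, ContDiffAt ℝ ∞ f z

theorem SmoothNear.contDiffAt {f : E → F} {x : E} (h : SmoothNear f x) : ContDiffAt ℝ ∞ f x :=
  Eventually.self_of_nhds h

theorem SmoothNear.continuousAt {f : E → F} {x : E} (h : SmoothNear f x) : ContinuousAt f x :=
  h.contDiffAt.continuousAt

theorem SmoothNear.differentiableAt {f : E → F} {x : E} (h : SmoothNear f x) :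
    DifferentiableAt ℝ f x :=
  h.contDiffAt.differentiableAt (by simp)

theorem ContDiff.smoothNear {f : E → F} (h : ContDiff ℝ ∞ f) (x : E) : SmoothNear f x :=
  Eventually.of_forall fun _ => h.contDiffAt

theorem ContDiffOn.smoothNear {f : E → F} {s : Set E} (h : ContDiffOn ℝ ∞ f s) {x : E}
    (hs : s ∈ 𝓝 x) : SmoothNear f x :=
  (eventually_mem_nhds_iff.2 hs).mono fun _ hz => h.contDiffAt hz

theorem SmoothNear.comp {f : F → G} {g : E → F} {x : E} (hf : SmoothNear f (g x))
    (hg : SmoothNear g x) : SmoothNear (fun z => f (g z)) x :=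
  (hg.continuousAt.eventually hf).mp (hg.mono fun z h1 h2 => ContDiffAt.comp z h2 h1)

theorem SmoothNear.comp_of_eq {f : F → G} {g : E → F} {x : E} {y : F} (hf : SmoothNear f y)
    (hg : SmoothNear g x) (hy : g x = y) : SmoothNear (fun z => f (g z)) x := by
  subst hy; exact hf.comp hg

theorem SmoothNear.prodMk {f : E → F} {g : E → G} {x : E} (hf : SmoothNear f x)
    (hg : SmoothNear g x) : SmoothNear (fun z => (f z, g z)) x :=
  (hf.and hg).mono fun _ hz => hz.1.prodMk hz.2

theorem SmoothNear.fderiv {f : E → F} {x : E} (hf : SmoothNear f x) :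
    SmoothNear (fderiv ℝ f) x :=
  hf.mono fun _ hz => hz.fderiv_right (m := ∞) (by simp)

theorem SmoothNear.pi {ι : Type*} [Fintype ι] {f : ι → E → ℝ} {x : E}
    (hf : ∀ i, SmoothNear (f i) x) : SmoothNear (fun z i => f i z) x :=
  (eventually_all.2 hf).mono fun _ hz => contDiffAt_pi.2 hz

/-- The integral of a smooth function over rays from the origin is differentiable. -/
theorem hasFDerivAt_integral_ray [FiniteDimensional ℝ E] {w : ℝ → ℝ} (hw : Continuous w)
    {f : E → F} (hf : ContDiff ℝ 1 f) (z : E) :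
    HasFDerivAt (fun z => ∫ t in (0 : ℝ)..1, w t • f (t • z))
      (∫ t in (0 : ℝ)..1, (w t * t) • fderiv ℝ f (t • z)) z := by
  have hf' : Continuous (fderiv ℝ f) := hf.continuous_fderiv (by simp)
  have hc : Continuous (fun p : ℝ × E => (w p.1 * p.1) • fderiv ℝ f (p.1 • p.2)) := by fun_prop
  obtain ⟨C, hC⟩ := (isCompact_Icc (a := (0:ℝ)) (b := 1)).prod
    (isCompact_closedBall z 1) |>.exists_bound_of_continuousOn hc.continuousOn
  refine (intervalIntegral.hasFDerivAt_integral_of_dominated_of_fderiv_le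
    (F := fun z t => w t • f (t • z)) (F' := fun z t => (w t * t) • fderiv ℝ f (t • z))
    (bound := fun _ => C) (Metric.ball_mem_nhds z one_pos) ?_ ?_ ?_ ?_ ?_ ?_)
  · exact Eventually.of_forall fun y => by
      have := hf.continuous
      exact (by fun_prop : Continuous fun t => w t • f (t • y)).aestronglyMeasurable
  · have := hf.continuous
    exact (by fun_prop : Continuous fun t => w t • f (t • z)).intervalIntegrable _ _
  · exact (by fun_prop : Continuous fun t => (w t * t) • fderiv ℝ f (t • z)).aestronglyMeasurable
  · refine Eventually.of_forall fun t ht y hy => ?_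
    rw [uIoc_of_le zero_le_one] at ht
    exact hC (t, y) ⟨⟨ht.1.le, ht.2⟩, Metric.ball_subset_closedBall hy⟩
  · exact intervalIntegrable_const
  · refine Eventually.of_forall fun t _ y _ => ?_
    have h1 : HasFDerivAt (fun y : E => t • y) (t • ContinuousLinearMap.id ℝ E) y :=
      (hasFDerivAt_id y).const_smul t
    have h2 := ((hf.differentiable (by simp) (t • y)).hasFDerivAt.comp y h1).const_smul (w t)
    have h3 : (w t * t) • fderiv ℝ f (t • y)
        = w t • (fderiv ℝ f (t • y)).comp (t • ContinuousLinearMap.id ℝ E) := by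
      ext u
      simp [mul_smul]
    rw [h3]
    exact h2

/-- Differentiating a weighted ray integral gives another one, with weight `w t * t` and integrand
`fderiv ℝ f`, so the induction varies `w`, `f` and `F`. The universe `max u v` is stable under
passing from `F` to `E →L[ℝ] F`. -/
theorem contDiff_integral_ray_nat.{u, v} {E : Type u} [NormedAddCommGroup E] [NormedSpace ℝ E]
    [FiniteDimensional ℝ E] (n : ℕ) : ∀ {F : Type (max u v)} [NormedAddCommGroup F] [NormedSpace ℝ F] {w : ℝ → ℝ} (_ : Continuous w)
    {f : E → F} (_ : ContDiff ℝ ∞ f),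
    ContDiff ℝ n (fun z => ∫ t in (0 : ℝ)..1, w t • f (t • z)) := by
  induction n with
  | zero =>
    intro F _ _ w hw f hf
    have h : ContDiff ℝ 1 f := hf.of_le (by simp)
    exact contDiff_zero.2 (continuous_iff_continuousAt.2 fun z =>
      (hasFDerivAt_integral_ray hw h z).continuousAt)
  | succ n ih =>
    intro F _ _ w hw f hf
    have h : ContDiff ℝ 1 f := hf.of_le (by simp)
    push_cast
    refine (contDiff_succ_iff_hasFDerivAt (n := n)).2 ⟨_, ?_, fun z => hasFDerivAt_integral_ray hw h z⟩
    exact ih (F := E →L[ℝ] F) (w := fun t => w t * t) (by fun_prop) (hf.fderiv_right (m := ∞) (by simp))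

/-- **Hadamard's lemma**. -/
theorem exists_contDiff_eq_add_apply [FiniteDimensional ℝ E] [CompleteSpace F] {f : E → F}
    (hf : ContDiff ℝ ∞ f) :
    ∃ K : E → E →L[ℝ] F, ContDiff ℝ ∞ K ∧ ∀ z, f z = f 0 + K z z := by
  have h1 : ContDiff ℝ 1 f := hf.of_le (by simp)
  have hf' : Continuous (fderiv ℝ f) := h1.continuous_fderiv (by simp)
  -- The mean of the derivative along the ray; the weight `1` only serves to match the previous
  -- lemma.
  refine ⟨fun z => ∫ t in (0 : ℝ)..1, (1 : ℝ) • fderiv ℝ f (t • z), ?_, fun z => ?_⟩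
  · exact contDiff_infty.2 fun n => contDiff_integral_ray_nat (F := E →L[ℝ] F) n continuous_const
      (hf.fderiv_right (m := ∞) (by simp))
  · have hi : IntervalIntegrable (fun t : ℝ => (1 : ℝ) • fderiv ℝ f (t • z)) volume 0 1 :=
      (by fun_prop : Continuous fun t : ℝ => (1 : ℝ) • fderiv ℝ f (t • z)).intervalIntegrable _ _
    rw [ContinuousLinearMap.intervalIntegral_apply hi]
    have := intervalIntegral.integral_eq_sub_of_hasDerivAt (a := 0) (b := 1)
      (f := fun t : ℝ => f (t • z)) (f' := fun t => ((1 : ℝ) • fderiv ℝ f (t • z)) z)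
      (fun t _ => ?_)
      ((by fun_prop : Continuous fun t : ℝ => ((1 : ℝ) • fderiv ℝ f (t • z)) z).intervalIntegrable _ _)
    · rw [this]; simp
    · have h1 : HasDerivAt (fun t : ℝ => t • z) z t := by
        simpa using (hasDerivAt_id t).smul_const z
      have := (hf.differentiable (by simp) (t • z)).hasFDerivAt.comp_hasDerivAt t h1
      simpa [Function.comp_def] using this

/-- A germ of a smooth function extends to a globally smooth function. -/
theorem SmoothNear.exists_contDiff_eventuallyEq [FiniteDimensional ℝ E] {f : E → F} {x : E}
    (hf : SmoothNear f x) : ∃ g : E → F, ContDiff ℝ ∞ g ∧ g =ᶠ[𝓝 x] f := by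
  obtain ⟨ε, hε, h⟩ := Metric.eventually_nhds_iff_ball.1 hf
  let χ : ContDiffBump x := ⟨ε / 4, ε / 2, by positivity, by linarith⟩
  refine ⟨fun z => χ z • f z, contDiff_iff_contDiffAt.2 fun z => ?_, ?_⟩
  · by_cases hz : z ∈ Metric.ball x ε
    · exact χ.contDiffAt.smul (h z hz)
    · have : (fun z => χ z • f z) =ᶠ[𝓝 z] fun _ => 0 := by
        have hz' : z ∈ (Metric.closedBall x (ε / 2))ᶜ := by
          simp only [Metric.mem_ball, not_lt, mem_compl_iff, Metric.mem_closedBall, not_le] at hz ⊢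
          linarith
        filter_upwards [Metric.isClosed_closedBall.isOpen_compl.mem_nhds hz'] with y hy
        rw [χ.zero_of_le_dist, zero_smul]
        simp only [mem_compl_iff, Metric.mem_closedBall, not_le] at hy
        exact hy.le
      exact contDiffAt_const.congr_of_eventuallyEq this
  · filter_upwards [χ.eventuallyEq_one] with z hz
    simp [hz]

/-- The inverse function theorem for germs of smooth maps. -/
theorem SmoothNear.exists_openPartialHomeomorph [CompleteSpace E] {f : E → F} {x : E}
    (hf : SmoothNear f x) {f' : E ≃L[ℝ] F} (hf' : HasFDerivAt f (f' : E →L[ℝ] F) x) :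
    ∃ e : OpenPartialHomeomorph E F, x ∈ e.source ∧ (∀ z, e z = f z) ∧
      ContDiffOn ℝ ∞ f e.source ∧ ContDiffOn ℝ ∞ e.symm e.target := by
  have h0 := hf.contDiffAt
  let e₀ := h0.toOpenPartialHomeomorph f hf' (by simp)
  have he₀ : ∀ z, e₀ z = f z := fun z => rfl
  have hx : x ∈ e₀.source := h0.mem_toOpenPartialHomeomorph_source hf' (by simp)
  -- Smoothness of the inverse is wanted on the whole target, so the domain is cut down to points
  -- where the derivative is still invertible, an open condition.
  have hd : ∀ᶠ z in 𝓝 x, _root_.fderiv ℝ f z ∈ range ((↑) : (E ≃L[ℝ] F) → E →L[ℝ] F) := by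
    refine hf.fderiv.continuousAt.eventually (ContinuousLinearEquiv.isOpen.mem_nhds ?_)
    exact ⟨f', hf'.fderiv.symm⟩
  obtain ⟨s, hs, hso, hxs⟩ := eventually_nhds_iff.1 (hf.and hd)
  refine ⟨e₀.restrOpen s hso, ⟨hx, hxs⟩, fun z => he₀ z, fun z hz => ?_, fun y hy => ?_⟩
  · exact (hs z hz.2).1.contDiffWithinAt
  · have hz : e₀.symm y ∈ s := (e₀.restrOpen s hso).map_target hy |>.2
    obtain ⟨g, hg⟩ := (hs _ hz).2
    refine (OpenPartialHomeomorph.contDiffAt_symm (e₀.restrOpen s hso) hy (f₀' := g) ?_ ?_).contDiffWithinAt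
    · change HasFDerivAt f _ (e₀.symm y)
      rw [hg]
      exact ((hs _ hz).1.differentiableAt (by simp)).hasFDerivAt
    · exact (hs _ hz).1

/-- The second derivative of a composition at a critical point. -/
theorem fderiv_fderiv_comp_of_critical {f : F → ℝ} {θ : E → F} {x : E}
    (hf : SmoothNear f (θ x)) (hθ : SmoothNear θ x) (hc : fderiv ℝ f (θ x) = 0) (u v : E) :
    fderiv ℝ (fderiv ℝ (fun z => f (θ z))) x u v
      = fderiv ℝ (fderiv ℝ f) (θ x) (fderiv ℝ θ x u) (fderiv ℝ θ x v) := by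
  have h1 : fderiv ℝ (fun z => f (θ z)) =ᶠ[𝓝 x]
      fun z => (fderiv ℝ f (θ z)).comp (fderiv ℝ θ z) := by
    filter_upwards [hθ.continuousAt.eventually hf, hθ] with z h1 h2
    exact ((h1.differentiableAt (by simp)).hasFDerivAt.comp z
      (h2.differentiableAt (by simp)).hasFDerivAt).fderiv
  have h2 : HasFDerivAt (fun z => fderiv ℝ f (θ z)) _ x :=
    hf.fderiv.differentiableAt.hasFDerivAt.comp x hθ.differentiableAt.hasFDerivAt
  rw [h1.fderiv_eq, (h2.clm_comp hθ.fderiv.differentiableAt.hasFDerivAt).fderiv]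
  -- The term containing the second derivative of `θ` is multiplied by `fderiv ℝ f (θ x) = 0`.
  simp [hc]

end Calculus

/-! ### The equivariant Morse lemma -/

section MorseLemma

variable {V : Type*} [NormedAddCommGroup V] [NormedSpace ℝ V]

/-- In the product rule the term with the derivative of `K` is evaluated at the vector `0` and drops
out. -/
theorem hasFDerivAt_apply_self {F : Type*} [NormedAddCommGroup F] [NormedSpace ℝ F]
    {K : V → V →L[ℝ] F} (hK : DifferentiableAt ℝ K 0) :
    HasFDerivAt (fun z => K z z) (K 0) 0 := by
  have h := hK.hasFDerivAt.clm_apply (hasFDerivAt_id (0 : V))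
  have h2 : (K 0).comp (ContinuousLinearMap.id ℝ V) + (fderiv ℝ K 0).flip (id 0) = K 0 := by
    ext u
    simp
  rw [h2] at h
  exact h

theorem contDiff_flip {n : ℕ∞ω} :
    ContDiff ℝ n (fun A : V →L[ℝ] V →L[ℝ] ℝ => A.flip) :=
  (IsBoundedLinearMap.contDiff (𝕜 := ℝ)
    ⟨⟨fun _ _ => rfl, fun _ _ => rfl⟩, 1, one_pos, fun A => by
      rw [A.opNorm_flip, one_mul]⟩)

theorem fderiv_fderiv_apply_self {N : V → V →L[ℝ] ℝ} (hN : SmoothNear N 0) (c : ℝ) (u v : V) :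
    fderiv ℝ (fderiv ℝ (fun z => c + N z z)) 0 u v = fderiv ℝ N 0 u v + fderiv ℝ N 0 v u := by
  have h1 : fderiv ℝ (fun z => c + N z z) =ᶠ[𝓝 0] fun z => N z + (fderiv ℝ N z).flip z := by
    filter_upwards [hN] with z hz
    have h := (hz.differentiableAt (by simp)).hasFDerivAt.clm_apply (hasFDerivAt_id z)
    refine (h.const_add c).fderiv.trans ?_
    ext u
    simp
  have h2 : DifferentiableAt ℝ (fun z => (fderiv ℝ N z).flip) 0 :=
    (contDiff_flip (n := 1)).differentiable (by simp) _ |>.comp (0 : V) hN.fderiv.differentiableAt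
  rw [h1.fderiv_eq, show fderiv ℝ (fun z => N z + (fderiv ℝ N z).flip z) 0 = _ from
    (hN.differentiableAt.hasFDerivAt.add (hasFDerivAt_apply_self h2)).fderiv]
  simp

/-- Second order Hadamard lemma: a smooth germ with a critical point at the origin, invariant under
a linear involution, is given by a smooth invariant family of symmetric bilinear forms. -/
theorem exists_symmetric_bilinear_family [FiniteDimensional ℝ V] {g : V → ℝ}
    (hg : SmoothNear g 0) (hcrit : fderiv ℝ g 0 = 0) {T : V →L[ℝ] V} (hT : ∀ v, T (T v) = v)
    (hgT : ∀ᶠ z in 𝓝 0, g (T z) = g z) :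
    ∃ B : V → V →L[ℝ] V →L[ℝ] ℝ, ContDiff ℝ ∞ B ∧ (∀ z u v, B z u v = B z v u) ∧
      (∀ z u v, B (T z) (T u) (T v) = B z u v) ∧ (∀ᶠ z in 𝓝 0, g z = g 0 + B z z z) ∧
      ∀ u v, fderiv ℝ (fderiv ℝ g) 0 u v = 2 * B 0 u v := by
  obtain ⟨g', hg', hgg'⟩ := hg.exists_contDiff_eventuallyEq
  obtain ⟨K, hK, hK'⟩ := exists_contDiff_eq_add_apply hg'
  obtain ⟨J, hJ, hJ'⟩ := exists_contDiff_eq_add_apply hK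
  have hK0 : K 0 = 0 := by
    have h1 : HasFDerivAt g' (K 0) 0 := by
      rw [show g' = fun z => g' 0 + K z z from funext hK']
      exact (hasFDerivAt_apply_self (hK.differentiable (by simp) 0)).const_add _
    rw [← h1.fderiv, hgg'.fderiv_eq, hcrit]
  have hgJ : ∀ᶠ z in 𝓝 0, g z = g 0 + J z z z := by
    filter_upwards [hgg'] with z hz
    rw [← hz, ← hgg'.self_of_nhds, hK' z, hJ' z, hK0, zero_add]
  have hT0 : Tendsto T (𝓝 0) (𝓝 0) := by simpa using T.continuous.tendsto 0
  let J' : V → V →L[ℝ] V →L[ℝ] ℝ := fun z => (((J (T z)).comp T).flip.comp T).flip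
  have hJT : ContDiff ℝ ∞ J' :=
    contDiff_flip.comp ((contDiff_flip.comp ((hJ.comp T.contDiff).clm_comp contDiff_const)).clm_comp contDiff_const)
  -- Average over the group generated by swapping arguments and pulling back by `T`. The value `B z
  -- z z` is still `g z - g 0`, because `g` is invariant.
  let B : V → V →L[ℝ] V →L[ℝ] ℝ := fun z =>
    (4⁻¹ : ℝ) • (J z + (J z).flip + (J' z + (J' z).flip))
  have hB : ContDiff ℝ ∞ B := ContDiff.const_smul _
    ((hJ.add (contDiff_flip.comp hJ)).add (hJT.add (contDiff_flip.comp hJT)))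
  have hBa : ∀ z u v, B z u v
      = 4⁻¹ * (J z u v + J z v u + (J (T z) (T u) (T v) + J (T z) (T v) (T u))) := by
    intro z u v; simp [B, J']; ring
  have hBs : ∀ z u v, B z u v = B z v u := fun z u v => by rw [hBa, hBa]; ring
  have hBg : ∀ᶠ z in 𝓝 0, g z = g 0 + B z z z := by
    filter_upwards [hgJ, hT0.eventually hgJ, hgT] with z h1 h2 h3
    rw [hBa]
    linarith
  refine ⟨B, hB, hBs, fun z u v => by rw [hBa, hBa]; simp only [hT]; ring, hBg, fun u v => ?_⟩
  have hBN : ContDiff ℝ ∞ (fun z => B z z) := hB.clm_apply contDiff_id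
  have : g =ᶠ[𝓝 0] fun z => g 0 + (fun z => B z z) z z := hBg
  rw [this.fderiv.fderiv_eq, fderiv_fderiv_apply_self (hBN.smoothNear 0),
    (hasFDerivAt_apply_self (hB.differentiable (by simp) 0)).fderiv, hBs 0 v u]
  ring

/-- Smooth square roots near the unit of a Banach algebra. -/
theorem exists_sq_openPartialHomeomorph (𝔸 : Type*) [NormedRing 𝔸] [NormedAlgebra ℝ 𝔸]
    [CompleteSpace 𝔸] :
    ∃ e : OpenPartialHomeomorph 𝔸 𝔸, 1 ∈ e.source ∧ (∀ X, e X = X * X) ∧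
      ContDiffOn ℝ ∞ e.symm e.target := by
  have h1 : ContDiff ℝ ∞ (fun X : 𝔸 => X * X) := contDiff_id.mul contDiff_id
  -- At the unit the derivative `X ↦ 1 * X + X * 1` is multiplication by the invertible scalar `2`.
  have h2 : HasFDerivAt (fun X : 𝔸 => X * X)
      ((ContinuousLinearEquiv.smulLeft (Units.mk0 (2 : ℝ) two_ne_zero) : 𝔸 ≃L[ℝ] 𝔸) : 𝔸 →L[ℝ] 𝔸)
      1 := by
    refine ((hasFDerivAt_id (𝕜 := ℝ) (1 : 𝔸)).mul' (hasFDerivAt_id (𝕜 := ℝ) (1 : 𝔸))).congr_fderiv ?_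
    ext X
    simp [two_smul, Units.smul_def]
  obtain ⟨e, he1, he2, -, he3⟩ := (h1.smoothNear 1).exists_openPartialHomeomorph h2
  exact ⟨e, he1, he2, he3⟩

/-- The **Morse lemma**, equivariant with respect to a linear involution. -/
theorem exists_equivariant_morse_coordinates [FiniteDimensional ℝ V] {g : V → ℝ}
    (hg : SmoothNear g 0) (hcrit : fderiv ℝ g 0 = 0)
    (hnd : ∀ u, (∀ v, fderiv ℝ (fderiv ℝ g) 0 u v = 0) → u = 0)
    {T : V →L[ℝ] V} (hT : ∀ v, T (T v) = v) (hgT : ∀ᶠ z in 𝓝 0, g (T z) = g z) :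
    ∃ A : V →L[ℝ] V →L[ℝ] ℝ, (∀ u v, A u v = A v u) ∧ (∀ u v, A (T u) (T v) = A u v) ∧
      (∀ u, (∀ v, A u v = 0) → u = 0) ∧
      ∃ H : V → V, SmoothNear H 0 ∧ H 0 = 0 ∧ HasFDerivAt H (ContinuousLinearMap.id ℝ V) 0 ∧
        (∀ᶠ z in 𝓝 0, g z = g 0 + A (H z) (H z)) ∧ ∀ᶠ z in 𝓝 0, H (T z) = T (H z) := by
  obtain ⟨B, hB, hBs, hBT, hBg, hBH⟩ := exists_symmetric_bilinear_family hg hcrit hT hgT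
  have hAnd : ∀ u, (∀ v, B 0 u v = 0) → u = 0 := fun u hu => hnd u fun v => by simp [hBH, hu]
  have hAT : ∀ u v, B 0 (T u) (T v) = B 0 u v := fun u v => by simpa using hBT 0 u v
  have hAinj : Injective (B 0) := by
    refine (injective_iff_map_eq_zero (B 0)).2 fun u hu => hAnd u fun v => by simp [hu]
  refine ⟨B 0, hBs 0, hAT, hAnd, ?_⟩
  have hfr : Module.finrank ℝ V = Module.finrank ℝ (V →L[ℝ] ℝ) := by
    rw [← (LinearMap.toContinuousLinearMap (𝕜 := ℝ) (E := V) (F' := ℝ)).finrank_eq]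
    exact Subspace.dual_finrank_eq.symm
  let Ae : V ≃L[ℝ] (V →L[ℝ] ℝ) := (LinearEquiv.ofInjectiveOfFinrankEq
    (B 0 : V →ₗ[ℝ] V →L[ℝ] ℝ) hAinj hfr).toContinuousLinearEquiv
  have hAe : ∀ u, Ae u = B 0 u := fun u => rfl
  have hAs : ∀ φ v, B 0 (Ae.symm φ) v = φ v := fun φ v => by rw [← hAe, Ae.apply_symm_apply]
  have hext : ∀ X Y : V →L[ℝ] V, (∀ u v, B 0 (X u) v = B 0 (Y u) v) → X = Y := fun X Y h =>
    ContinuousLinearMap.ext fun u => hAinj (ContinuousLinearMap.ext fun v => h u v)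
  -- The operator representing `B z` with respect to `B 0`; it is the identity at the origin, so it
  -- has a smooth square root nearby.
  let R : V → V →L[ℝ] V := fun z => (Ae.symm : (V →L[ℝ] ℝ) →L[ℝ] V).comp (B z)
  have hR : ContDiff ℝ ∞ R := contDiff_const.clm_comp hB
  have hRa : ∀ z u v, B 0 (R z u) v = B z u v := fun z u v => hAs _ _
  have hR0 : R 0 = 1 := hext _ _ fun u v => hRa 0 u v
  obtain ⟨e, he1, he2, he3⟩ := exists_sq_openPartialHomeomorph (V →L[ℝ] V)
  have hR0e : R 0 ∈ e.target := by
    have := e.map_source he1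
    rwa [he2, one_mul, ← hR0] at this
  let C : V → V →L[ℝ] V := fun z => e.symm (R z)
  have hC : SmoothNear C 0 :=
    (he3.smoothNear (e.open_target.mem_nhds hR0e)).comp (hR.smoothNear 0)
  have hC0 : C 0 = 1 := by
    have := e.left_inv he1
    rw [he2, one_mul] at this
    simpa only [C, hR0] using this
  have hCsrc : ∀ᶠ z in 𝓝 0, C z ∈ e.source ∧ C z * C z = R z := by
    filter_upwards [hR.continuous.continuousAt.eventually (e.open_target.mem_nhds hR0e)] with z hz
    exact ⟨e.map_target hz, by rw [← he2]; exact e.right_inv hz⟩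
  have hT0 : Tendsto T (𝓝 0) (𝓝 0) := by simpa using T.continuous.tendsto 0
  -- the adjoint with respect to the bilinear form
  let st : (V →L[ℝ] V) → V →L[ℝ] V := fun X =>
    (Ae.symm : (V →L[ℝ] ℝ) →L[ℝ] V).comp
      (((ContinuousLinearMap.compL ℝ V V ℝ).flip X).comp (Ae : V →L[ℝ] V →L[ℝ] ℝ))
  have hst : ∀ X u v, B 0 (st X u) v = B 0 u (X v) := fun X u v => by
    simp only [st, ContinuousLinearMap.comp_apply, ContinuousLinearEquiv.coe_coe, hAs]
    simp [hAe]
  have hst1 : st 1 = 1 := hext _ _ fun u v => hst 1 u v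
  have hstc : Continuous st := by fun_prop
  -- Both sides lie in `e.source`, where squaring is injective, and both square to `R z`, which is
  -- self-adjoint by symmetry of `B z`.
  have hadj : ∀ᶠ z in 𝓝 0, st (C z) = C z := by
    have h1 : ∀ᶠ z in 𝓝 0, st (C z) ∈ e.source :=
      (hstc.continuousAt.comp hC.continuousAt).eventually
        (e.open_source.mem_nhds (by simpa [hC0, hst1] using he1))
    filter_upwards [h1, hCsrc] with z h1 h2
    refine e.injOn h1 h2.1 ?_
    rw [he2, he2, h2.2]
    refine hext _ _ fun u v => ?_
    rw [mul_apply_eq_comp, hst, hst, ← mul_apply_eq_comp, h2.2, hBs 0 u,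
      hRa, hRa, hBs]
  -- Uniqueness of the root again: invariance of `B` gives `R (T z) = T * R z * T`.
  have hequi : ∀ᶠ z in 𝓝 0, C (T z) = T * C z * T := by
    have hTT : T * 1 * T = 1 := ContinuousLinearMap.ext fun v => hT v
    have h1 : ∀ᶠ z in 𝓝 0, T * C z * T ∈ e.source := by
      have hc : ContinuousAt (fun z => T * C z * T) 0 :=
        (continuousAt_const.mul hC.continuousAt).mul continuousAt_const
      exact hc.eventually (e.open_source.mem_nhds (by simpa only [hC0, hTT] using he1))
    filter_upwards [h1, hCsrc, hT0.eventually hCsrc] with z h1 h2 h3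
    refine e.injOn h3.1 h1 ?_
    rw [he2, he2, h3.2]
    refine hext _ _ fun u v => ?_
    simp only [mul_apply_eq_comp, hT]
    rw [← mul_apply_eq_comp (C z) (C z), h2.2, hRa, ← hAT, hT, hRa, ← hBT z, hT, hT]
  -- With `C z` self-adjoint, `B 0 (C z z) (C z z) = B 0 (R z z) z = B z z z`.
  refine ⟨fun z => C z z, ?_, by simp, ?_, ?_, ?_⟩
  · exact hC.mono fun z hz => hz.clm_apply contDiffAt_id
  · have := hasFDerivAt_apply_self hC.differentiableAt
    rwa [hC0] at this
  · filter_upwards [hBg, hadj, hCsrc] with z h1 h2 h3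
    rw [h1, ← hst, h2, ← mul_apply_eq_comp, h3.2, hRa]
  · filter_upwards [hequi] with z hz
    simp [hz, hT]

end MorseLemma

/-! ### Linear algebra of involutions, invariant forms and invariant functionals -/

section LinearAlgebra

/-- A family of signs can be reordered so that the negative ones come first. -/
theorem exists_perm_sorted_signs {n : ℕ} (w : Fin n → ℝ) (hw : ∀ i, w i = -1 ∨ w i = 1) :
    ∃ a ≤ n, ∃ σ : Equiv.Perm (Fin n), ∀ i : Fin n,
      w (σ i) = if (i : ℕ) < a then -1 else 1 := by
  classical
  let a := Fintype.card {i // w i = -1}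
  have ha : a ≤ n := (Fintype.card_subtype_le _).trans_eq (Fintype.card_fin n)
  have hcard : Fintype.card {i : Fin n // (i : ℕ) < a} = Fintype.card {i // w i = -1} := by
    rw [Fintype.card_subtype, Fin.card_filter_val_lt, min_eq_right ha]
  let e := Fintype.equivOfCardEq hcard
  -- A bijection between two subsets of a finite type extends to a permutation.
  refine ⟨a, ha, e.extendSubtype, fun i => ?_⟩
  by_cases hi : (i : ℕ) < a
  · rw [if_pos hi]
    exact e.extendSubtype_mem i hi
  · rw [if_neg hi]
    exact (hw _).resolve_left (e.extendSubtype_not_mem i hi)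

/-- **Sylvester's law of inertia** with the negative squares first. -/
theorem exists_linearEquiv_sorted_squares {V : Type*} [AddCommGroup V] [Module ℝ V]
    [FiniteDimensional ℝ V] (A : V →ₗ[ℝ] V →ₗ[ℝ] ℝ) (hA : ∀ u v, A u v = A v u)
    (hnd : ∀ u, (∀ v, A u v = 0) → u = 0) :
    ∃ n, ∃ a ≤ n, ∃ L : V ≃ₗ[ℝ] (Fin n → ℝ), ∀ v,
      A v v = ∑ i : Fin n, if (i : ℕ) < a then -(L v i) ^ 2 else (L v i) ^ 2 := by
  have hsep : (QuadraticMap.associated (R := ℝ) (LinearMap.BilinMap.toQuadraticMap A)).SeparatingLeft := by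
    have : QuadraticMap.associated (R := ℝ) (LinearMap.BilinMap.toQuadraticMap A) = A :=
      QuadraticMap.associated_left_inverse ℝ hA
    rw [this]
    exact hnd
  obtain ⟨w, hw, ⟨e⟩⟩ := QuadraticForm.equivalent_one_neg_one_weighted_sum_squared _ hsep
  obtain ⟨a, ha, σ, hσ⟩ := exists_perm_sorted_signs w hw
  refine ⟨_, a, ha, e.toLinearEquiv.trans (LinearEquiv.funCongrLeft ℝ ℝ σ), fun v => ?_⟩
  have h := e.map_app v
  rw [LinearMap.BilinMap.toQuadraticMap_apply, QuadraticMap.weightedSumSquares_apply,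
    ← Equiv.sum_comp σ] at h
  rw [← h]
  refine Finset.sum_congr rfl fun i _ => ?_
  rw [hσ]
  split_ifs <;> simp [LinearEquiv.funCongrLeft_apply, LinearMap.funLeft_apply, pow_two]

/-- The splitting of a vector space into the eigenspaces of an involution. -/
noncomputable def involutionSplitting {V : Type*} [AddCommGroup V] [Module ℝ V] (T : V →ₗ[ℝ] V)
    (hT : ∀ v, T (T v) = v) :
    V ≃ₗ[ℝ] LinearMap.ker (T + LinearMap.id) × LinearMap.ker (T - LinearMap.id) where
  toFun v := (⟨(2⁻¹ : ℝ) • (v - T v), by simp [hT]⟩,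
    ⟨(2⁻¹ : ℝ) • (v + T v), by simp [hT, add_comm]⟩)
  map_add' u v := by
    ext <;> simp only [map_add, Prod.fst_add, Prod.snd_add, Submodule.coe_add] <;> module
  map_smul' c v := by
    ext <;> simp only [map_smul, Prod.smul_fst, Prod.smul_snd, Submodule.coe_smul, RingHom.id_apply]
      <;> module
  invFun p := p.1 + p.2
  left_inv v := by simp only; module
  right_inv p := by
    obtain ⟨⟨x, hx⟩, ⟨y, hy⟩⟩ := p
    have hx' : T x = -x := by simpa [add_eq_zero_iff_eq_neg] using hx
    have hy' : T y = y := by simpa [sub_eq_zero] using hy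
    ext <;> simp only [map_add, hx', hy'] <;> module

/-- Diagonalization of an involution, from coordinates on its eigenspaces. -/
noncomputable def involutionCoordinates {V : Type*} [AddCommGroup V] [Module ℝ V] {T : V →ₗ[ℝ] V}
    (hT : ∀ v, T (T v) = v) {ι κ : Type*}
    (f : LinearMap.ker (T + LinearMap.id) ≃ₗ[ℝ] (ι → ℝ))
    (g : LinearMap.ker (T - LinearMap.id) ≃ₗ[ℝ] (κ → ℝ)) : V ≃ₗ[ℝ] (ι ⊕ κ → ℝ) :=
  ((involutionSplitting T hT).trans (f.prodCongr g)).trans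
    (LinearEquiv.sumArrowLequivProdArrow ι κ ℝ ℝ).symm

section

variable {V : Type*} [AddCommGroup V] [Module ℝ V] {T : V →ₗ[ℝ] V} (hT : ∀ v, T (T v) = v)
  {ι κ : Type*} (f : LinearMap.ker (T + LinearMap.id) ≃ₗ[ℝ] (ι → ℝ))
  (g : LinearMap.ker (T - LinearMap.id) ≃ₗ[ℝ] (κ → ℝ))

theorem involutionCoordinates_inl (v : V) (i : ι) :
    involutionCoordinates hT f g v (Sum.inl i) = f (involutionSplitting T hT v).1 i := rfl

theorem involutionCoordinates_inr (v : V) (i : κ) :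
    involutionCoordinates hT f g v (Sum.inr i) = g (involutionSplitting T hT v).2 i := rfl

theorem involutionSplitting_map (v : V) : involutionSplitting T hT (T v)
    = (-(involutionSplitting T hT v).1, (involutionSplitting T hT v).2) := by
  ext
  · simp only [involutionSplitting, LinearEquiv.coe_mk, LinearMap.coe_mk, AddHom.coe_mk, hT,
      Submodule.coe_neg]
    module
  · simp only [involutionSplitting, LinearEquiv.coe_mk, LinearMap.coe_mk, AddHom.coe_mk, hT]
    module

theorem involutionCoordinates_map_inl (v : V) (i : ι) :
    involutionCoordinates hT f g (T v) (Sum.inl i)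
      = -involutionCoordinates hT f g v (Sum.inl i) := by
  simp [involutionCoordinates_inl, involutionSplitting_map]

theorem involutionCoordinates_map_inr (v : V) (i : κ) :
    involutionCoordinates hT f g (T v) (Sum.inr i)
      = involutionCoordinates hT f g v (Sum.inr i) := by
  simp [involutionCoordinates_inr, involutionSplitting_map]

end

/-- Simultaneous diagonalization of an involution and an invariant nondegenerate symmetric form. -/
theorem exists_linearEquiv_involution_form {V : Type*} [AddCommGroup V] [Module ℝ V]
    [FiniteDimensional ℝ V] {T : V →ₗ[ℝ] V} (hT : ∀ v, T (T v) = v)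
    (A : V →ₗ[ℝ] V →ₗ[ℝ] ℝ) (hA : ∀ u v, A u v = A v u) (hAT : ∀ u v, A (T u) (T v) = A u v)
    (hnd : ∀ u, (∀ v, A u v = 0) → u = 0) :
    ∃ r p, ∃ a ≤ r, ∃ b ≤ p, ∃ L : V ≃ₗ[ℝ] (Fin r ⊕ Fin p → ℝ),
      (∀ v i, L (T v) (Sum.inl i) = -L v (Sum.inl i)) ∧
      (∀ v i, L (T v) (Sum.inr i) = L v (Sum.inr i)) ∧
      ∀ v, A v v = (∑ i : Fin r, if (i : ℕ) < a then -(L v (Sum.inl i)) ^ 2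
          else (L v (Sum.inl i)) ^ 2)
        + ∑ i : Fin p, if (i : ℕ) < b then -(L v (Sum.inr i)) ^ 2 else (L v (Sum.inr i)) ^ 2 := by
  let N := LinearMap.ker (T + LinearMap.id)
  let P := LinearMap.ker (T - LinearMap.id)
  have hN : ∀ x : N, T x = -x := fun x => by
    exact add_eq_zero_iff_eq_neg.1 (LinearMap.mem_ker.1 x.2)
  have hP : ∀ y : P, T y = y := fun y => by
    exact sub_eq_zero.1 (LinearMap.mem_ker.1 y.2)
  -- Invariance gives `A x y = A (-x) y`. Orthogonality also makes the form nondegenerate on each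
  -- eigenspace.
  have horth : ∀ (x : N) (y : P), A x y = 0 := fun x y => by
    have := hAT x y
    rw [hN, hP, map_neg, LinearMap.neg_apply] at this
    linarith
  have hsplit : ∀ v, v = ((involutionSplitting T hT v).1 : V) + (involutionSplitting T hT v).2 :=
    fun v => ((involutionSplitting T hT).symm_apply_apply v).symm
  obtain ⟨r, a, ha, f, hf⟩ := exists_linearEquiv_sorted_squares
    (A.compl₁₂ N.subtype N.subtype) (fun u v => hA _ _) fun u hu => Subtype.ext <| hnd u fun v => by
      rw [hsplit v, map_add, horth, add_zero]
      exact hu (involutionSplitting T hT v).1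
  obtain ⟨p, b, hb, g, hg⟩ := exists_linearEquiv_sorted_squares
    (A.compl₁₂ P.subtype P.subtype) (fun u v => hA _ _) fun u hu => Subtype.ext <| hnd u fun v => by
      rw [hsplit v, map_add, hA, horth, zero_add]
      exact hu (involutionSplitting T hT v).2
  refine ⟨r, p, a, ha, b, hb, involutionCoordinates hT f g, involutionCoordinates_map_inl hT f g,
    involutionCoordinates_map_inr hT f g, fun v => ?_⟩
  simp only [involutionCoordinates_inl, involutionCoordinates_inr]
  rw [← hf, ← hg]
  conv_lhs => rw [hsplit v]
  simp only [map_add, LinearMap.add_apply, horth, hA _ (_ : N).1, LinearMap.compl₁₂_apply,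
    Submodule.subtype_apply]
  ring

/-- A nonzero functional is the first coordinate in a suitable linear coordinate system. -/
theorem exists_linearEquiv_first_coordinate {U : Type*} [AddCommGroup U] [Module ℝ U]
    [FiniteDimensional ℝ U] {μ : U →ₗ[ℝ] ℝ} (hμ : μ ≠ 0) :
    ∃ (s : ℕ) (hs : 0 < s) (L : U ≃ₗ[ℝ] (Fin s → ℝ)), ∀ u, L u ⟨0, hs⟩ = μ u := by
  obtain ⟨u₁, hu₁⟩ : ∃ u, μ u ≠ 0 := by
    by_contra! h
    exact hμ (LinearMap.ext h)
  let u₀ := (μ u₁)⁻¹ • u₁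
  have hu₀ : μ u₀ = 1 := by simp [u₀, hu₁]
  -- The splitting `u = μ u • u₀ + (u - μ u • u₀)`, possible since `μ u₀ = 1`.
  let e : U ≃ₗ[ℝ] ℝ × LinearMap.ker μ :=
    { toFun := fun u => (μ u, ⟨u - μ u • u₀, by simp [hu₀]⟩)
      map_add' := fun u v => by
        ext
        · simp
        · simp only [map_add, Prod.snd_add, Submodule.coe_add]; module
      map_smul' := fun c v => by
        ext
        · simp
        · simp only [map_smul, Prod.smul_snd, Submodule.coe_smul, RingHom.id_apply, smul_eq_mul]
          module
      invFun := fun p => p.1 • u₀ + p.2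
      left_inv := fun u => by simp
      right_inv := fun p => by
        have hp : μ p.2 = 0 := p.2.2
        ext <;> simp [hu₀, hp] }
  refine ⟨_, Nat.succ_pos _, (e.trans ((LinearEquiv.refl ℝ ℝ).prodCongr
    (Module.finBasis ℝ (LinearMap.ker μ)).equivFun)).trans
    (Fin.consLinearEquiv ℝ (fun _ => ℝ)), fun u => ?_⟩
  rfl

/-- Diagonalization of an involution with a given invariant functional as coordinate. -/
theorem exists_linearEquiv_involution_functional {W : Type*} [AddCommGroup W] [Module ℝ W]
    [FiniteDimensional ℝ W] {T : W →ₗ[ℝ] W} (hT : ∀ v, T (T v) = v) {μ : W →ₗ[ℝ] ℝ}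
    (hμ : μ ≠ 0) (hμT : ∀ v, μ (T v) = μ v) :
    ∃ (q s : ℕ) (hs : 0 < s) (L : W ≃ₗ[ℝ] (Fin q ⊕ Fin s → ℝ)),
      (∀ v i, L (T v) (Sum.inl i) = -L v (Sum.inl i)) ∧
      (∀ v i, L (T v) (Sum.inr i) = L v (Sum.inr i)) ∧ ∀ v, L v (Sum.inr ⟨0, hs⟩) = μ v := by
  -- An invariant functional vanishes on the `-1` eigenspace, so its restriction to the `+1`
  -- eigenspace is still nonzero.
  have hsplit : ∀ v, μ v = μ (involutionSplitting T hT v).2 := fun v => by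
    change μ v = μ ((2⁻¹ : ℝ) • (v + T v))
    rw [map_smul, map_add, hμT, smul_eq_mul]
    ring
  obtain ⟨s, hs, g, hg⟩ := exists_linearEquiv_first_coordinate
    (μ := μ.comp (LinearMap.ker (T - LinearMap.id)).subtype) fun h => hμ <| LinearMap.ext fun v => by
      rw [hsplit]
      exact LinearMap.congr_fun h (involutionSplitting T hT v).2
  refine ⟨_, s, hs, involutionCoordinates hT (Module.finBasis ℝ _).equivFun g,
    involutionCoordinates_map_inl hT _ g, involutionCoordinates_map_inr hT _ g, fun v => ?_⟩
  rw [involutionCoordinates_inr, hg, hsplit]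
  rfl

end LinearAlgebra

/-! ### Linearizing the involution and the local normal form in `V × W` -/

section LocalNormalForm

variable {V W : Type*} [NormedAddCommGroup V] [NormedAddCommGroup W]

theorem tendsto_mk_zero : Tendsto (fun v : V => (v, (0 : W))) (𝓝 0) (𝓝 0) :=
  (by fun_prop : Continuous fun v : V => (v, (0 : W))).tendsto' _ _ rfl

variable [NormedSpace ℝ V]

/-- The restriction to the invariant subspace of an invariant function, expressed in linearizing
coordinates, is invariant under the linearized involution. -/
theorem eventually_comp_localInverse_invariant {τ : V × W → V × W} (hτ : ContinuousAt τ 0)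
    (hτ0 : τ 0 = 0) (hτV : ∀ᶠ v in 𝓝 (0 : V), (τ (v, 0)).2 = 0) {G : V × W → ℝ}
    (hGτ : ∀ᶠ z in 𝓝 0, G (τ z) = G z) {T₁ : V →L[ℝ] V} {P : V × W → V} (hP0 : P 0 = 0)
    (hPτ : ∀ᶠ z in 𝓝 0, P (τ z) = T₁ (P z)) {e : OpenPartialHomeomorph V V} (he0 : 0 ∈ e.source)
    (he : ∀ v, e v = P (v, 0)) :
    ∀ᶠ v in 𝓝 0, G (e.symm (T₁ v), 0) = G (e.symm v, 0) := by
  have he00 : e 0 = 0 := (he 0).trans hP0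
  have hS0 : e.symm 0 = 0 := by
    have := e.left_inv he0
    rwa [he00] at this
  have h0t : (0 : V) ∈ e.target := by
    have := e.map_source he0
    rwa [he00] at this
  have hS : Tendsto e.symm (𝓝 0) (𝓝 0) := by
    have := (e.continuousAt_symm h0t).tendsto
    rwa [hS0] at this
  have hτt : Tendsto τ (𝓝 0) (𝓝 0) := by
    have := hτ.tendsto
    rwa [hτ0] at this
  have hτ1 : Tendsto (fun v : V => (τ (v, 0)).1) (𝓝 0) (𝓝 0) :=
    (continuous_fst.tendsto' 0 0 rfl).comp (hτt.comp tendsto_mk_zero)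
  filter_upwards [e.open_target.mem_nhds h0t, hS.eventually hτV,
    hS.eventually (tendsto_mk_zero.eventually hGτ), hS.eventually (tendsto_mk_zero.eventually hPτ),
    hS.eventually (hτ1.eventually (e.open_source.mem_nhds he0))] with v h1 h2 h3 h4 h5
  have hv : P (e.symm v, 0) = v := by rw [← he, e.right_inv h1]
  have hτv : τ (e.symm v, 0) = ((τ (e.symm v, 0)).1, 0) := Prod.ext rfl h2
  -- On `V` the local diffeomorphism `e` conjugates `τ` to `T₁`.
  have h6 : e.symm (T₁ v) = (τ (e.symm v, 0)).1 := by
    rw [hv, hτv, ← he] at h4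
    rw [← h4, e.left_inv h5]
  rw [h6, ← hτv, h3]

variable [NormedSpace ℝ W]

theorem SmoothNear.comp_mk_zero {F : Type*} [NormedAddCommGroup F] [NormedSpace ℝ F]
    {f : V × W → F} (hf : SmoothNear f 0) : SmoothNear (fun v => f (v, 0)) 0 :=
  hf.comp_of_eq ((contDiff_id.prodMk contDiff_const).smoothNear 0) rfl

theorem HasFDerivAt.comp_mk_zero {F : Type*} [NormedAddCommGroup F] [NormedSpace ℝ F]
    {f : V × W → F} {f' : V × W →L[ℝ] F} (hf : HasFDerivAt f f' 0) :
    HasFDerivAt (fun v => f (v, 0)) (f'.comp (ContinuousLinearMap.inl ℝ V W)) 0 :=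
  HasFDerivAt.comp (f := fun v : V => (v, (0 : W))) 0 hf
    (ContinuousLinearMap.inl ℝ V W).hasFDerivAt

/-- Linearization of a smooth involution germ preserving a linear subspace. -/
theorem exists_linearizing_coordinates {τ : V × W → V × W} (hτ : SmoothNear τ 0) (hτ0 : τ 0 = 0)
    (hττ : ∀ᶠ z in 𝓝 0, τ (τ z) = z) (hτV : ∀ᶠ v in 𝓝 (0 : V), (τ (v, 0)).2 = 0) :
    ∃ (T₁ : V →L[ℝ] V) (T₂ : W →L[ℝ] W) (P : V × W → V) (Q : V × W → W),
      (∀ v, T₁ (T₁ v) = v) ∧ (∀ w, T₂ (T₂ w) = w) ∧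
      (∀ w, ∃ v, fderiv ℝ τ 0 (0, w) = (v, T₂ w)) ∧
      SmoothNear P 0 ∧ SmoothNear Q 0 ∧ P 0 = 0 ∧
      (∃ D : V × W →L[ℝ] V, HasFDerivAt P D 0 ∧ ∀ v, D (v, 0) = v) ∧
      HasFDerivAt Q (ContinuousLinearMap.snd ℝ V W) 0 ∧
      (∀ᶠ z in 𝓝 0, P (τ z) = T₁ (P z)) ∧ (∀ᶠ z in 𝓝 0, Q (τ z) = T₂ (Q z)) ∧
      ∀ᶠ v in 𝓝 (0 : V), Q (v, 0) = 0 := by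
  set T := fderiv ℝ τ 0
  have hT : HasFDerivAt τ T 0 := hτ.differentiableAt.hasFDerivAt
  have hTT : ∀ z, T (T z) = z := by
    have h1 : HasFDerivAt (fun z => τ (τ z)) (T.comp T) 0 :=
      HasFDerivAt.comp 0 (by rw [hτ0]; exact hT) hT
    have h2 : HasFDerivAt (fun z => τ (τ z)) (ContinuousLinearMap.id ℝ (V × W)) 0 :=
      (hasFDerivAt_id 0).congr_of_eventuallyEq hττ
    exact fun z => DFunLike.congr_fun (h1.unique h2) z
  have hTV : ∀ v, (T (v, 0)).2 = 0 := by
    have h1 := ((ContinuousLinearMap.snd ℝ V W).hasFDerivAt.comp 0 hT).comp_mk_zero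
    have h2 : HasFDerivAt (fun v : V => (τ (v, 0)).2) (0 : V →L[ℝ] W) 0 :=
      (hasFDerivAt_const (0 : W) (0 : V)).congr_of_eventuallyEq hτV
    exact fun v => DFunLike.congr_fun (h1.unique h2) v
  let T₁ : V →L[ℝ] V :=
    (ContinuousLinearMap.fst ℝ V W).comp (T.comp (ContinuousLinearMap.inl ℝ V W))
  let T₂ : W →L[ℝ] W :=
    (ContinuousLinearMap.snd ℝ V W).comp (T.comp (ContinuousLinearMap.inr ℝ V W))
  have hT₁ : ∀ v, T (v, 0) = (T₁ v, 0) := fun v => Prod.ext rfl (hTV v)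
  have hT₂ : ∀ z, (T z).2 = T₂ z.2 := fun z => by
    have : z = (z.1, 0) + (0, z.2) := by simp
    conv_lhs => rw [this, map_add, Prod.snd_add, hTV, zero_add]
    rfl
  have hT₁₁ : ∀ v, T₁ (T₁ v) = v := fun v => by
    have := congrArg Prod.fst (hTT (v, 0))
    rwa [hT₁, hT₁] at this
  have hT₂₂ : ∀ w, T₂ (T₂ w) = w := fun w => by
    have := congrArg Prod.snd (hTT (0, w))
    rwa [hT₂, hT₂] at this
  have hτs1 : SmoothNear (fun z => (τ z).1) 0 := (contDiff_fst.smoothNear _).comp hτ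
  have hτs2 : SmoothNear (fun z => (τ z).2) 0 := (contDiff_snd.smoothNear _).comp hτ
  -- Averaging with the diagonal blocks instead of the full differential makes the linearized
  -- involution block diagonal. The price is that the derivative of `P` is the identity only on `V`.
  refine ⟨T₁, T₂, fun z => (2⁻¹ : ℝ) • (z.1 + T₁ (τ z).1), fun z => (2⁻¹ : ℝ) • (z.2 + T₂ (τ z).2),
    hT₁₁, hT₂₂, fun w => ⟨_, Prod.ext rfl (hT₂ (0, w))⟩, ?_, ?_, by simp [hτ0], ?_, ?_, ?_, ?_, ?_⟩
  · exact hτs1.mono fun z hz => (contDiffAt_fst.add (T₁.contDiff.contDiffAt.comp z hz)).const_smul _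
  · exact hτs2.mono fun z hz => (contDiffAt_snd.add (T₂.contDiff.contDiffAt.comp z hz)).const_smul _
  · refine ⟨(2⁻¹ : ℝ) • (ContinuousLinearMap.fst ℝ V W
      + T₁.comp ((ContinuousLinearMap.fst ℝ V W).comp T)), ?_, fun v => ?_⟩
    · exact (hasFDerivAt_fst.add (T₁.hasFDerivAt.comp 0
        ((ContinuousLinearMap.fst ℝ V W).hasFDerivAt.comp 0 hT))).const_smul _
    · simp only [smul_apply, add_apply, ContinuousLinearMap.comp_apply, ContinuousLinearMap.coe_fst',
        hT₁, hT₁₁]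
      module
  · have h := (hasFDerivAt_snd.add (T₂.hasFDerivAt.comp 0
        ((ContinuousLinearMap.snd ℝ V W).hasFDerivAt.comp 0 hT))).const_smul (2⁻¹ : ℝ)
    refine h.congr_fderiv (ContinuousLinearMap.ext fun z => ?_)
    simp only [smul_apply, add_apply,
      ContinuousLinearMap.comp_apply, ContinuousLinearMap.coe_snd', hT₂, hT₂₂]
    module
  · filter_upwards [hττ] with z hz
    simp [hz, hT₁₁, add_comm]
  · filter_upwards [hττ] with z hz
    simp [hz, hT₂₂, add_comm]
  · filter_upwards [hτV] with v hv
    simp [hv]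

/-- Normal form of an invariant function and a smooth involution near a point of an invariant
submanifold at which the restricted function has a nondegenerate critical point. -/
theorem exists_local_normal_form [FiniteDimensional ℝ V] [FiniteDimensional ℝ W]
    {τ : V × W → V × W} (hτ : SmoothNear τ 0) (hτ0 : τ 0 = 0)
    (hττ : ∀ᶠ z in 𝓝 0, τ (τ z) = z) (hτV : ∀ᶠ v in 𝓝 (0 : V), (τ (v, 0)).2 = 0)
    {G : V × W → ℝ} (hG : SmoothNear G 0) (hGτ : ∀ᶠ z in 𝓝 0, G (τ z) = G z)
    (hcrit : fderiv ℝ (fun v => G (v, 0)) 0 = 0)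
    (hnd : ∀ u, (∀ v, fderiv ℝ (fderiv ℝ (fun v => G (v, 0))) 0 u v = 0) → u = 0)
    (hdG : fderiv ℝ G 0 ≠ 0) :
    ∃ (r p q s : ℕ) (hs : 0 < s), ∃ a ≤ r, ∃ b ≤ p,
      ∃ (Φ₁ : V × W → Fin r ⊕ Fin p → ℝ) (Φ₂ : V × W → Fin q ⊕ Fin s → ℝ)
        (L₁ : V ≃L[ℝ] (Fin r ⊕ Fin p → ℝ)) (L₂ : W ≃L[ℝ] (Fin q ⊕ Fin s → ℝ))
        (D₁ : V × W →L[ℝ] (Fin r ⊕ Fin p → ℝ)),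
        SmoothNear Φ₁ 0 ∧ SmoothNear Φ₂ 0 ∧ Φ₁ 0 = 0 ∧
        HasFDerivAt Φ₁ D₁ 0 ∧ (∀ v, D₁ (v, 0) = L₁ v) ∧
        HasFDerivAt Φ₂ ((L₂ : W →L[ℝ] (Fin q ⊕ Fin s → ℝ)).comp
          (ContinuousLinearMap.snd ℝ V W)) 0 ∧
        (∀ᶠ v in 𝓝 (0 : V), Φ₂ (v, 0) = 0) ∧
        (∀ᶠ z in 𝓝 0, (∀ i, Φ₁ (τ z) (Sum.inl i) = -Φ₁ z (Sum.inl i)) ∧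
          (∀ i, Φ₁ (τ z) (Sum.inr i) = Φ₁ z (Sum.inr i)) ∧
          (∀ i, Φ₂ (τ z) (Sum.inl i) = -Φ₂ z (Sum.inl i)) ∧
          (∀ i, Φ₂ (τ z) (Sum.inr i) = Φ₂ z (Sum.inr i))) ∧
        ∀ᶠ z in 𝓝 0, G z = G 0
          + (∑ i : Fin r, if (i : ℕ) < a then -(Φ₁ z (Sum.inl i)) ^ 2
              else (Φ₁ z (Sum.inl i)) ^ 2)
          + (∑ i : Fin p, if (i : ℕ) < b then -(Φ₁ z (Sum.inr i)) ^ 2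
              else (Φ₁ z (Sum.inr i)) ^ 2)
          + Φ₂ z (Sum.inr ⟨0, hs⟩) := by
  obtain ⟨T₁, T₂, P, Q, hT₁, hT₂, hTW, hP, hQ, hP0, ⟨D, hD, hDV⟩, hQ', hPτ, hQτ, hQV⟩ :=
    exists_linearizing_coordinates hτ hτ0 hττ hτV
  -- the restriction to `V`, in linearizing coordinates
  have hPV' : HasFDerivAt (fun v => P (v, 0))
      ((ContinuousLinearEquiv.refl ℝ V : V ≃L[ℝ] V) : V →L[ℝ] V) 0 :=
    hD.comp_mk_zero.congr_fderiv (ContinuousLinearMap.ext hDV)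
  obtain ⟨e, he0, he, -, hes⟩ := hP.comp_mk_zero.exists_openPartialHomeomorph hPV'
  have he00 : e 0 = 0 := (he 0).trans hP0
  have hS0 : e.symm 0 = 0 := by
    have := e.left_inv he0
    rwa [he00] at this
  have h0t : (0 : V) ∈ e.target := by
    have := e.map_source he0
    rwa [he00] at this
  have hS : SmoothNear e.symm 0 := hes.smoothNear (e.open_target.mem_nhds h0t)
  have hS' : fderiv ℝ e.symm 0 = ContinuousLinearMap.id ℝ V := by
    have h1 : HasFDerivAt e ((ContinuousLinearEquiv.refl ℝ V : V ≃L[ℝ] V) : V →L[ℝ] V)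
        (e.symm 0) := by
      rw [hS0, funext he]; exact hPV'
    exact (e.hasFDerivAt_symm h0t h1).fderiv
  have hf : SmoothNear (fun v => G (v, 0)) 0 := hG.comp_mk_zero
  have hg : SmoothNear (fun v => G (e.symm v, 0)) 0 :=
    SmoothNear.comp_of_eq (f := fun v => G (v, 0)) hf hS hS0
  have hgcrit : fderiv ℝ (fun v => G (e.symm v, 0)) 0 = 0 := by
    have h := HasFDerivAt.comp (g := fun v => G (v, 0)) (0 : V)
      (by rw [hS0]; exact hf.differentiableAt.hasFDerivAt) hS.differentiableAt.hasFDerivAt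
    rw [hcrit, ContinuousLinearMap.zero_comp] at h
    exact h.fderiv
  have hgnd : ∀ u, (∀ v, fderiv ℝ (fderiv ℝ (fun v => G (e.symm v, 0))) 0 u v = 0) → u = 0 := by
    refine fun u hu => hnd u fun v => ?_
    have := fderiv_fderiv_comp_of_critical (f := fun v => G (v, 0)) (θ := e.symm) (x := 0)
      (by rwa [hS0]) hS (by rwa [hS0]) u v
    rw [hS', hS0] at this
    exact this.symm.trans (hu v)
  have hgT : ∀ᶠ v in 𝓝 0, G (e.symm (T₁ v), 0) = G (e.symm v, 0) :=
    eventually_comp_localInverse_invariant hτ.continuousAt hτ0 hτV hGτ hP0 hPτ he0 he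
  obtain ⟨A, hA, hAT, hAnd, H, hH, hH0, hH', hgH, hHT⟩ :=
    exists_equivariant_morse_coordinates hg hgcrit hgnd hT₁ hgT
  obtain ⟨r, p, a, ha, b, hb, L₁, hL₁n, hL₁p, hL₁A⟩ := exists_linearEquiv_involution_form
    (T := (T₁ : V →ₗ[ℝ] V)) hT₁ (A.toLinearMap₁₂) hA hAT hAnd
  -- the differential of `G` in the normal direction
  have hG' : HasFDerivAt G (fderiv ℝ G 0) 0 := hG.differentiableAt.hasFDerivAt
  have hGV : ∀ v, fderiv ℝ G 0 (v, 0) = 0 := fun v => by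
    have := hG'.comp_mk_zero.fderiv
    rw [hcrit] at this
    exact (DFunLike.congr_fun this v).symm
  have hGW : ∀ z : V × W, fderiv ℝ G 0 z = fderiv ℝ G 0 (0, z.2) := fun z => by
    have : z = (z.1, 0) + (0, z.2) := by simp
    conv_lhs => rw [this, map_add, hGV, zero_add]
  let μ : W →L[ℝ] ℝ := (fderiv ℝ G 0).comp (ContinuousLinearMap.inr ℝ V W)
  have hμ0 : (μ : W →ₗ[ℝ] ℝ) ≠ 0 := fun h => hdG <| ContinuousLinearMap.ext fun z => by
    rw [hGW]
    exact DFunLike.congr_fun h z.2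
  -- Differentiate `G ∘ τ = G`. The differential of `τ` on `W` is `T₂` up to a vector of `V`, which
  -- `fderiv ℝ G 0` kills.
  have hμT : ∀ w, μ (T₂ w) = μ w := fun w => by
    have h1 : HasFDerivAt (fun z => G (τ z)) ((fderiv ℝ G 0).comp (fderiv ℝ τ 0)) 0 :=
      HasFDerivAt.comp 0 (by rw [hτ0]; exact hG') hτ.differentiableAt.hasFDerivAt
    have h2 : HasFDerivAt (fun z => G (τ z)) (fderiv ℝ G 0) 0 := hG'.congr_of_eventuallyEq hGτ
    have h3 := DFunLike.congr_fun (h1.unique h2) (0, w)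
    obtain ⟨v, hv⟩ := hTW w
    rw [ContinuousLinearMap.comp_apply, hv, hGW] at h3
    exact h3
  obtain ⟨q, s, hs, L₂, hL₂n, hL₂p, hL₂μ⟩ := exists_linearEquiv_involution_functional
    (T := (T₂ : W →ₗ[ℝ] W)) hT₂ hμ0 hμT
  -- The quadratic part is extended off `V` through `P`; everything it misses becomes the
  -- distinguished coordinate.
  let R : V × W → ℝ := fun z => G z - G 0 - A (H (P z)) (H (P z))
  -- Replacing the coordinate `μ ∘ Q` by `R` leaves the derivative at `0` unchanged, as both have
  -- differential `fderiv ℝ G 0`.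
  let Φ₂ : V × W → Fin q ⊕ Fin s → ℝ := fun z i =>
    if i = Sum.inr ⟨0, hs⟩ then R z else L₂ (Q z) i
  have hΦ₂0 : ∀ z, Φ₂ z (Sum.inr ⟨0, hs⟩) = R z := fun z => if_pos rfl
  have hΦ₂ne : ∀ z i, i ≠ Sum.inr ⟨0, hs⟩ → Φ₂ z i = L₂ (Q z) i := fun z i hi => if_neg hi
  have hHP : SmoothNear (fun z => H (P z)) 0 := hH.comp_of_eq hP hP0
  have hHPd : HasFDerivAt (fun z => H (P z)) D 0 := by
    have := HasFDerivAt.comp (g := H) (0 : V × W) (by rw [hP0]; exact hH') hD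
    exact this
  have hAd : HasFDerivAt (fun z => A (H (P z)) (H (P z))) (0 : V × W →L[ℝ] ℝ) 0 := by
    have h := (A.hasFDerivAt.comp (0 : V × W) hHPd).clm_apply hHPd
    refine h.congr_fderiv (ContinuousLinearMap.ext fun z => ?_)
    simp [hP0, hH0]
  have hR : SmoothNear R 0 := by
    filter_upwards [hG, hHP] with z h1 h2
    exact (h1.sub contDiffAt_const).sub ((A.contDiff.contDiffAt.comp z h2).clm_apply h2)
  have hR' : HasFDerivAt R (fderiv ℝ G 0) 0 := by
    have := (hG'.sub_const (G 0)).sub hAd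
    rw [sub_zero] at this
    exact this
  have hRτ : ∀ᶠ z in 𝓝 0, R (τ z) = R z := by
    have hPt : Tendsto P (𝓝 0) (𝓝 0) := by
      have := hP.continuousAt.tendsto
      rwa [hP0] at this
    filter_upwards [hGτ, hPτ, hPt.eventually hHT] with z h1 h2 h3
    simp only [R]
    rw [h1, h2, h3, hAT]
  have hRV : ∀ᶠ v in 𝓝 (0 : V), R (v, 0) = 0 := by
    have het : Tendsto e (𝓝 0) (𝓝 0) := by
      have := (e.continuousAt he0).tendsto
      rwa [he00] at this
    filter_upwards [e.open_source.mem_nhds he0, het.eventually hgH] with v h1 h2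
    rw [e.left_inv h1, hS0, he] at h2
    simp only [R]
    rw [h2]
    change G 0 + _ - G 0 - _ = 0
    ring
  let L₁' := L₁.toContinuousLinearEquiv
  let L₂' := L₂.toContinuousLinearEquiv
  refine ⟨r, p, q, s, hs, a, ha, b, hb, fun z => L₁' (H (P z)), Φ₂, L₁', L₂',
    (L₁' : V →L[ℝ] (Fin r ⊕ Fin p → ℝ)).comp D, ?_, ?_, by simp [hP0, hH0], ?_, fun v => by simp [hDV], ?_, ?_, ?_, ?_⟩
  · exact (L₁'.contDiff.smoothNear _).comp hHP
  · refine SmoothNear.pi (f := fun i z => Φ₂ z i) fun i => ?_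
    by_cases hi : i = Sum.inr ⟨0, hs⟩
    · subst hi
      simpa only [hΦ₂0] using hR
    · simp only [hΦ₂ne _ i hi]
      exact ((contDiff_pi.1 L₂'.contDiff i).smoothNear _).comp hQ
  · exact (L₁' : V →L[ℝ] (Fin r ⊕ Fin p → ℝ)).hasFDerivAt.comp 0 hHPd
  · refine hasFDerivAt_pi'.2 fun i => ?_
    by_cases hi : i = Sum.inr ⟨0, hs⟩
    · subst hi
      simp only [hΦ₂0]
      refine hR'.congr_fderiv (ContinuousLinearMap.ext fun z => ?_)
      rw [hGW]
      exact (hL₂μ z.2).symm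
    · simp only [hΦ₂ne _ i hi]
      exact ((ContinuousLinearMap.proj i).comp
        (L₂' : W →L[ℝ] (Fin q ⊕ Fin s → ℝ))).hasFDerivAt.comp 0 hQ'
  · filter_upwards [hRV, hQV] with v h1 h2
    ext i
    by_cases hi : i = Sum.inr ⟨0, hs⟩
    · subst hi
      rw [hΦ₂0, h1]; rfl
    · rw [hΦ₂ne _ i hi, h2]; simp
  · have hPt : Tendsto P (𝓝 0) (𝓝 0) := by
      have := hP.continuousAt.tendsto
      rwa [hP0] at this
    filter_upwards [hPτ, hPt.eventually hHT, hQτ, hRτ] with z h1 h2 h3 h4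
    refine ⟨fun i => ?_, fun i => ?_, fun i => ?_, fun i => ?_⟩
    · rw [h1, h2]; exact hL₁n _ i
    · rw [h1, h2]; exact hL₁p _ i
    · rw [hΦ₂ne _ _ (by simp), hΦ₂ne _ _ (by simp), h3]; exact hL₂n _ i
    · by_cases hi : (Sum.inr i : Fin q ⊕ Fin s) = Sum.inr ⟨0, hs⟩
      · rw [hi, hΦ₂0, hΦ₂0, h4]
      · rw [hΦ₂ne _ _ hi, hΦ₂ne _ _ hi, h3]; exact hL₂p _ i
  · refine Eventually.of_forall fun z => ?_
    rw [hΦ₂0]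
    have h1 : ∀ v, L₁' v = L₁ v := fun _ => rfl
    have h2 := hL₁A (H (P z))
    rw [ContinuousLinearMap.toLinearMap₁₂_apply_apply_apply] at h2
    simp only [R, h1]
    linarith

end LocalNormalForm

/-! ### Critical points and Hessians in arbitrary charts of the maximal atlas -/

section Charts

variable {d d' : ℕ} {X Y : Type*} [TopologicalSpace X]
  [ChartedSpace (EuclideanSpace ℝ (Fin d)) X] [TopologicalSpace Y]
  [ChartedSpace (EuclideanSpace ℝ (Fin d')) Y]

theorem OpenPartialHomeomorph.tendsto_symm_nhds {X Y : Type*} [TopologicalSpace X]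
    [TopologicalSpace Y] (e : OpenPartialHomeomorph X Y) {x : X} (hx : x ∈ e.source) :
    Tendsto e.symm (𝓝 (e x)) (𝓝 x) := by
  have := (e.continuousAt_symm (e.map_source hx)).tendsto
  rwa [e.left_inv hx] at this

theorem comp_chart_symm_eventuallyEq {X Y : Type*} [TopologicalSpace X] [TopologicalSpace Y]
    (f : X → ℝ) {e e' : OpenPartialHomeomorph X Y} {p : X} (hp : p ∈ e.source)
    (hp' : p ∈ e'.source) :
    (fun y => f (e.symm y)) =ᶠ[𝓝 (e p)] fun y => f (e'.symm (e' (e.symm y))) := by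
  filter_upwards [(e.tendsto_symm_nhds hp).eventually (e'.open_source.mem_nhds hp')] with y hy
  rw [e'.left_inv hy]

theorem ContMDiff.smoothNear_comp_chart_symm {f : X → ℝ} (hf : ContMDiff (𝓡 d) 𝓘(ℝ, ℝ) ∞ f)
    {e : OpenPartialHomeomorph X (EuclideanSpace ℝ (Fin d))}
    (he : e ∈ IsManifold.maximalAtlas (𝓡 d) ∞ X) {p : X} (hp : p ∈ e.source) :
    SmoothNear (fun y => f (e.symm y)) (e p) := by
  filter_upwards [e.open_target.mem_nhds (e.map_source hp)] with y hy
  exact contMDiffAt_iff_contDiffAt.1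
    (hf.contMDiffAt.comp y (contMDiffAt_symm_of_mem_maximalAtlas he hy))

theorem ContMDiff.smoothNear_chart_comp_chart_symm {f : X → Y}
    (hf : ContMDiff (𝓡 d) (𝓡 d') ∞ f)
    {e : OpenPartialHomeomorph X (EuclideanSpace ℝ (Fin d))}
    (he : e ∈ IsManifold.maximalAtlas (𝓡 d) ∞ X)
    {e' : OpenPartialHomeomorph Y (EuclideanSpace ℝ (Fin d'))}
    (he' : e' ∈ IsManifold.maximalAtlas (𝓡 d') ∞ Y) {p : X} (hp : p ∈ e.source)
    (hfp : f p ∈ e'.source) :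
    SmoothNear (fun y => e' (f (e.symm y))) (e p) := by
  have h : ∀ᶠ y in 𝓝 (e p), f (e.symm y) ∈ e'.source :=
    (hf.continuous.continuousAt.tendsto.comp (e.tendsto_symm_nhds hp)).eventually
      (e'.open_source.mem_nhds hfp)
  filter_upwards [e.open_target.mem_nhds (e.map_source hp), h] with y hy h
  exact contMDiffAt_iff_contDiffAt.1 ((contMDiffAt_of_mem_maximalAtlas he' h).comp y
    (hf.contMDiffAt.comp y (contMDiffAt_symm_of_mem_maximalAtlas he hy)))

variable {e e' : OpenPartialHomeomorph X (EuclideanSpace ℝ (Fin d))} {p : X}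

theorem smoothNear_transition (he : e ∈ IsManifold.maximalAtlas (𝓡 d) ∞ X)
    (he' : e' ∈ IsManifold.maximalAtlas (𝓡 d) ∞ X) (hp : p ∈ e.source) (hp' : p ∈ e'.source) :
    SmoothNear (fun y => e' (e.symm y)) (e p) :=
  (contMDiff_id (I := 𝓡 d) (M := X)).smoothNear_chart_comp_chart_symm he he' hp hp'

theorem fderiv_transition_comp (he : e ∈ IsManifold.maximalAtlas (𝓡 d) ∞ X)
    (he' : e' ∈ IsManifold.maximalAtlas (𝓡 d) ∞ X) (hp : p ∈ e.source) (hp' : p ∈ e'.source)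
    (v : EuclideanSpace ℝ (Fin d)) :
    fderiv ℝ (fun y => e (e'.symm y)) (e' p) (fderiv ℝ (fun y => e' (e.symm y)) (e p) v) = v := by
  have h1 := (smoothNear_transition he he' hp hp').differentiableAt.hasFDerivAt
  have h2 := (smoothNear_transition he' he hp' hp).differentiableAt.hasFDerivAt
  have h3 : HasFDerivAt (fun y => e (e'.symm (e' (e.symm y)))) _ (e p) :=
    HasFDerivAt.comp (g := fun y => e (e'.symm y)) (e p)
      (by rw [e.left_inv hp]; exact h2) h1
  have h4 : (fun y => e (e'.symm (e' (e.symm y)))) =ᶠ[𝓝 (e p)] id := by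
    filter_upwards [e.open_target.mem_nhds (e.map_source hp),
      (e.tendsto_symm_nhds hp).eventually (e'.open_source.mem_nhds hp')] with y hy hy'
    rw [e'.left_inv hy', e.right_inv hy, id]
  exact DFunLike.congr_fun (h3.unique ((hasFDerivAt_id _).congr_of_eventuallyEq h4)) v

/-- The chain rule through the transition map. It moves criticality between the preferred chart,
used by the definitions, and an adapted chart. -/
theorem fderiv_comp_chart_symm_eq_zero {f : X → ℝ} (hf : ContMDiff (𝓡 d) 𝓘(ℝ, ℝ) ∞ f)
    (he : e ∈ IsManifold.maximalAtlas (𝓡 d) ∞ X)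
    (he' : e' ∈ IsManifold.maximalAtlas (𝓡 d) ∞ X) (hp : p ∈ e.source) (hp' : p ∈ e'.source)
    (h : fderiv ℝ (fun y => f (e'.symm y)) (e' p) = 0) :
    fderiv ℝ (fun y => f (e.symm y)) (e p) = 0 := by
  rw [(comp_chart_symm_eventuallyEq f hp hp').fderiv_eq]
  have h1 := (smoothNear_transition he he' hp hp').differentiableAt.hasFDerivAt
  have h2 := (hf.smoothNear_comp_chart_symm he' hp').differentiableAt.hasFDerivAt
  rw [h] at h2
  have h3 := HasFDerivAt.comp (g := fun y => f (e'.symm y)) (e p)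
      (by rw [e.left_inv hp]; exact h2) h1
  rw [ContinuousLinearMap.zero_comp] at h3
  exact h3.fderiv

/-- Nondegeneracy of the second derivative at a critical point is independent of the chart. -/
theorem nondegenerate_comp_chart_symm {f : X → ℝ} (hf : ContMDiff (𝓡 d) 𝓘(ℝ, ℝ) ∞ f)
    (he : e ∈ IsManifold.maximalAtlas (𝓡 d) ∞ X)
    (he' : e' ∈ IsManifold.maximalAtlas (𝓡 d) ∞ X) (hp : p ∈ e.source) (hp' : p ∈ e'.source)
    (h : fderiv ℝ (fun y => f (e'.symm y)) (e' p) = 0)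
    (hnd : ∀ u, (∀ v, fderiv ℝ (fderiv ℝ (fun y => f (e'.symm y))) (e' p) u v = 0) → u = 0)
    (u : EuclideanSpace ℝ (Fin d))
    (hu : ∀ v, fderiv ℝ (fderiv ℝ (fun y => f (e.symm y))) (e p) u v = 0) : u = 0 := by
  have hkey := fderiv_fderiv_comp_of_critical (f := fun y => f (e'.symm y))
    (θ := fun y => e' (e.symm y)) (x := e p)
    (by rw [e.left_inv hp]; exact hf.smoothNear_comp_chart_symm he' hp')
    (smoothNear_transition he he' hp hp') (by rw [e.left_inv hp]; exact h)
  rw [← (comp_chart_symm_eventuallyEq f hp hp').fderiv.fderiv_eq, e.left_inv hp] at hkey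
  have h1 : fderiv ℝ (fun y => e' (e.symm y)) (e p) u = 0 := hnd _ fun v => by
    rw [← fderiv_transition_comp he' he hp' hp v, ← hkey, hu]
  rw [← fderiv_transition_comp he he' hp hp' u, h1, map_zero]

theorem isCriticalPoint_iff {f : X → ℝ} (hf : ContMDiff (𝓡 d) 𝓘(ℝ, ℝ) ∞ f) (p : X) :
    IsCriticalPoint d f p ↔
      fderiv ℝ (fun y => f ((chartAt (EuclideanSpace ℝ (Fin d)) p).symm y))
        (chartAt (EuclideanSpace ℝ (Fin d)) p p) = 0 := by
  have h : MDifferentiableAt (𝓡 d) 𝓘(ℝ, ℝ) f p := hf.mdifferentiableAt (by simp)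
  have h2 : mfderiv (𝓡 d) 𝓘(ℝ, ℝ) f p =
      fderiv ℝ (fun y => f ((chartAt (EuclideanSpace ℝ (Fin d)) p).symm y))
        (chartAt (EuclideanSpace ℝ (Fin d)) p p) := by
    refine h.mfderiv.trans ?_
    simp [writtenInExtChartAt, extChartAt, Function.comp_def]
    rfl
  rw [IsCriticalPoint, h2]
  rfl

/-- A vector in the kernel of the second derivative is annihilated by the Hessian matrix. The entry
`(i, j)` differentiates first along `i`, so `mulVec` pairs `u` with the outer slot and symmetry is
not needed. -/
theorem nondegenerate_of_hessianMatrix_det_ne_zero [IsManifold (𝓡 d) ∞ X] {f : X → ℝ}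
    (hf : ContMDiff (𝓡 d) 𝓘(ℝ, ℝ) ∞ f) (h : (hessianMatrix d f p).det ≠ 0)
    (u : EuclideanSpace ℝ (Fin d))
    (hu : ∀ v, fderiv ℝ (fderiv ℝ (fun y => f ((chartAt (EuclideanSpace ℝ (Fin d)) p).symm y)))
      (chartAt (EuclideanSpace ℝ (Fin d)) p p) u v = 0) : u = 0 := by
  set φ := chartAt (EuclideanSpace ℝ (Fin d)) p
  have hφ : SmoothNear (fun y => f (φ.symm y)) (φ p) :=
    hf.smoothNear_comp_chart_symm (IsManifold.chart_mem_maximalAtlas p) (mem_chart_source _ p)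
  have hH : ∀ i j, hessianMatrix d f p i j =
      fderiv ℝ (fderiv ℝ (fun y => f (φ.symm y))) (φ p) (EuclideanSpace.single j 1)
        (EuclideanSpace.single i 1) := by
    intro i j
    change fderiv ℝ (fun z => fderiv ℝ (fun y => f (φ.symm y)) z (EuclideanSpace.single i 1)) (φ p)
      (EuclideanSpace.single j 1) = _
    have := (hφ.fderiv.differentiableAt.hasFDerivAt).clm_apply
      (hasFDerivAt_const (EuclideanSpace.single i (1 : ℝ)) (φ p))
    rw [this.fderiv]
    simp
  have hu' : u = ∑ j, u j • EuclideanSpace.single j (1 : ℝ) := by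
    ext i
    simp [Pi.single_apply]
  have hz : (hessianMatrix d f p).mulVec u = 0 := by
    ext i
    rw [Matrix.mulVec, dotProduct]
    have := hu (EuclideanSpace.single i 1)
    rw [hu', map_sum, sum_apply] at this
    rw [Pi.zero_apply, ← this]
    refine Finset.sum_congr rfl fun j _ => ?_
    rw [hH, map_smul, smul_apply, smul_eq_mul, mul_comm]
  have := Matrix.eq_zero_of_mulVec_eq_zero h hz
  ext i
  exact congrFun this i

end Charts

/-! ### Building local coordinates, and invariance of codimension -/

section LocalCoordinates

variable {d : ℕ} {X : Type*} [TopologicalSpace X] [ChartedSpace (EuclideanSpace ℝ (Fin d)) X]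

theorem mem_contDiffGroupoid_of_contDiffOn
    {θ : OpenPartialHomeomorph (EuclideanSpace ℝ (Fin d)) (EuclideanSpace ℝ (Fin d))}
    (h : ContDiffOn ℝ ∞ θ θ.source) (h' : ContDiffOn ℝ ∞ θ.symm θ.target) :
    θ ∈ contDiffGroupoid ∞ (𝓡 d) := by
  rw [contDiffGroupoid, mem_groupoid_of_pregroupoid]
  constructor
  · simpa [contDiffPregroupoid] using h
  · simpa [contDiffPregroupoid] using h'

theorem trans_mem_maximalAtlas {e : OpenPartialHomeomorph X (EuclideanSpace ℝ (Fin d))}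
    (he : e ∈ IsManifold.maximalAtlas (𝓡 d) ∞ X)
    {θ : OpenPartialHomeomorph (EuclideanSpace ℝ (Fin d)) (EuclideanSpace ℝ (Fin d))}
    (hθ : θ ∈ contDiffGroupoid ∞ (𝓡 d)) :
    e.trans θ ∈ IsManifold.maximalAtlas (𝓡 d) ∞ X := by
  intro e' he'
  obtain ⟨h1, h2⟩ := he e' he'
  constructor
  · rw [OpenPartialHomeomorph.trans_symm_eq_symm_trans_symm, OpenPartialHomeomorph.trans_assoc]
    exact (contDiffGroupoid ∞ (𝓡 d)).trans ((contDiffGroupoid ∞ (𝓡 d)).symm hθ) h1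
  · rw [← OpenPartialHomeomorph.trans_assoc]
    exact (contDiffGroupoid ∞ (𝓡 d)).trans h2 hθ

/-- A smooth map with invertible differential, read in a chart, gives local coordinates. -/
theorem exists_isLocalCoordinates {e : OpenPartialHomeomorph X (EuclideanSpace ℝ (Fin d))}
    (he : e ∈ IsManifold.maximalAtlas (𝓡 d) ∞ X) {p : X} (hp : p ∈ e.source)
    {ι : Type*} [Fintype ι] {Ψ : EuclideanSpace ℝ (Fin d) → ι → ℝ} (hΨ : SmoothNear Ψ (e p))
    {D : EuclideanSpace ℝ (Fin d) ≃L[ℝ] (ι → ℝ)}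
    (hD : HasFDerivAt Ψ (D : EuclideanSpace ℝ (Fin d) →L[ℝ] (ι → ℝ)) (e p)) :
    ∃ N : Set X, IsOpen N ∧ p ∈ N ∧ N ⊆ e.source ∧ InjOn (fun u => Ψ (e u)) N ∧
      ∀ U ⊆ N, IsOpen U → IsLocalCoordinates d U (fun i u => Ψ (e u) i) := by
  have hcard : Fintype.card ι = Fintype.card (Fin d) := by
    have := D.toLinearEquiv.finrank_eq
    simpa using this.symm
  let c : ι ≃ Fin d := Fintype.equivOfCardEq hcard
  let κ : (ι → ℝ) ≃L[ℝ] EuclideanSpace ℝ (Fin d) :=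
    ((LinearEquiv.funCongrLeft ℝ ℝ c.symm).toContinuousLinearEquiv).trans
      (EuclideanSpace.equiv (Fin d) ℝ).symm
  have hκ : ∀ y i, κ y (c i) = y i := fun y i => by
    change y (c.symm (c i)) = y i
    rw [c.symm_apply_apply]
  obtain ⟨θ, hθp, hθ, hθ1, hθ2⟩ := SmoothNear.exists_openPartialHomeomorph
    (f := fun y => κ (Ψ y)) (f' := D.trans κ) ((κ.contDiff.smoothNear _).comp hΨ)
    (κ.hasFDerivAt.comp _ hD)
  have hθ' : θ ∈ contDiffGroupoid ∞ (𝓡 d) :=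
    mem_contDiffGroupoid_of_contDiffOn (hθ1.congr fun y _ => hθ y) hθ2
  have hmem := trans_mem_maximalAtlas he hθ'
  -- Every open subset `U` is allowed because the neighbourhood is shrunk later to a `τ`-invariant
  -- one.
  refine ⟨(e.trans θ).source, (e.trans θ).open_source, ?_, ?_, ?_, fun U hU hUo => ?_⟩
  · rw [OpenPartialHomeomorph.trans_source]
    exact ⟨hp, hθp⟩
  · rw [OpenPartialHomeomorph.trans_source]
    exact inter_subset_left
  · intro u hu u' hu' h
    refine (e.trans θ).injOn hu hu' ?_
    simp only [OpenPartialHomeomorph.coe_trans, comp_apply, hθ]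
    exact congrArg κ h
  · refine ⟨(e.trans θ).restr U, restr_mem_maximalAtlas (contDiffGroupoid ∞ (𝓡 d)) hmem hUo, ?_, c,
      fun u _ i => ?_⟩
    · rw [OpenPartialHomeomorph.restr_source, hUo.interior_eq]
      exact inter_eq_right.2 hU
    · change Ψ (e u) i = θ (e u) (c i)
      rw [hθ, hκ]

/-- Rank–nullity for the surjective projection onto the coordinates in `J`. -/
theorem finrank_coordinate_subspace {ι : Type*} (J : Finset ι) (c : ι ≃ Fin d) :
    J.card + Module.finrank ℝ (LinearMap.ker (LinearMap.pi fun i : J =>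
      (EuclideanSpace.proj (c i) : EuclideanSpace ℝ (Fin d) →L[ℝ] ℝ).toLinearMap)) = d := by
  classical
  set ρ := LinearMap.pi fun i : J =>
      (EuclideanSpace.proj (c i) : EuclideanSpace ℝ (Fin d) →L[ℝ] ℝ).toLinearMap with hρ
  have hsurj : Surjective ρ := by
    intro y
    refine ⟨WithLp.toLp 2 fun j => if h : c.symm j ∈ J then y ⟨_, h⟩ else 0, ?_⟩
    ext i
    simp [hρ]
  have h := ρ.finrank_range_add_finrank_ker
  rw [LinearMap.range_eq_top.2 hsurj, finrank_top] at h
  simpa using h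

/-- The codimension of a submanifold given by the vanishing of local coordinates is bounded by the
number of coordinates vanishing on it in any other coordinate system. -/
theorem card_le_card_of_isLocalCoordinates {S U U' : Set X} {ι ι' : Type*} {z : ι → X → ℝ}
    {z' : ι' → X → ℝ} (hz : IsLocalCoordinates d U z) (hz' : IsLocalCoordinates d U' z')
    {J : Finset ι} {J' : Finset ι'} (hJ : ∀ u ∈ U, u ∈ S ↔ ∀ i ∈ J, z i u = 0)
    (hJ' : ∀ u ∈ U', u ∈ S ↔ ∀ i ∈ J', z' i u = 0) {p : X} (hpS : p ∈ S) (hp : p ∈ U)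
    (hp' : p ∈ U') : J'.card ≤ J.card := by
  obtain ⟨e, he, rfl, c, hc⟩ := hz
  obtain ⟨e', he', rfl, c', hc'⟩ := hz'
  set ρ := LinearMap.pi fun i : J =>
      (EuclideanSpace.proj (c i) : EuclideanSpace ℝ (Fin d) →L[ℝ] ℝ).toLinearMap with hρ
  set ρ' := LinearMap.pi fun i : J' =>
      (EuclideanSpace.proj (c' i) : EuclideanSpace ℝ (Fin d) →L[ℝ] ℝ).toLinearMap with hρ'
  have h1 : J.card + Module.finrank ℝ (LinearMap.ker ρ) = d := finrank_coordinate_subspace J c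
  have h2 : J'.card + Module.finrank ℝ (LinearMap.ker ρ') = d := finrank_coordinate_subspace J' c'
  set D := fderiv ℝ (fun y => e' (e.symm y)) (e p) with hD
  have hDd : HasFDerivAt (fun y => e' (e.symm y)) D (e p) :=
    (smoothNear_transition he he' hp hp').differentiableAt.hasFDerivAt
  -- A short segment through `e p` in direction `ξ` stays in `S`, so the second system's vanishing
  -- coordinates are zero along it; differentiate at `p`.
  have hmap : ∀ ξ ∈ LinearMap.ker ρ, D ξ ∈ LinearMap.ker ρ' := by
    intro ξ hξ
    have hξ' : ∀ i ∈ J, ξ (c i) = 0 := fun i hi => congrFun (LinearMap.mem_ker.1 hξ) ⟨i, hi⟩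
    have hl : HasDerivAt (fun s : ℝ => e p + s • ξ) ξ 0 := by
      simpa using ((hasDerivAt_id (0 : ℝ)).smul_const ξ).const_add (e p)
    have hl0 : Tendsto (fun s : ℝ => e p + s • ξ) (𝓝 0) (𝓝 (e p)) := by
      simpa using hl.continuousAt.tendsto
    have hc1 : HasDerivAt (fun s : ℝ => e' (e.symm (e p + s • ξ))) (D ξ) 0 :=
      HasFDerivAt.comp_hasDerivAt (l := fun y => e' (e.symm y)) (0 : ℝ) (by simpa using hDd) hl
    refine LinearMap.mem_ker.2 (funext fun i => ?_)
    change D ξ (c' i) = 0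
    have hc2 : HasDerivAt (fun s : ℝ => e' (e.symm (e p + s • ξ)) (c' i)) (D ξ (c' i)) 0 :=
      (EuclideanSpace.proj (c' i) : EuclideanSpace ℝ (Fin d) →L[ℝ] ℝ).hasFDerivAt.comp_hasDerivAt
        (0 : ℝ) hc1
    have hev : (fun s : ℝ => e' (e.symm (e p + s • ξ)) (c' i)) =ᶠ[𝓝 0] fun _ => (0 : ℝ) := by
      filter_upwards [hl0.eventually (e.open_target.mem_nhds (e.map_source hp)),
        hl0.eventually ((e.tendsto_symm_nhds hp).eventually (e'.open_source.mem_nhds hp'))]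
        with s hs hs'
      rw [← hc' _ hs']
      refine (hJ' _ hs').1 ((hJ _ (e.map_target hs)).2 fun j hj => ?_) i i.2
      rw [hc _ (e.map_target hs), e.right_inv hs]
      have := (hJ p hp).1 hpS j hj
      rw [hc p hp] at this
      simp [this, hξ' j hj]
    exact hc2.unique ((hasDerivAt_const (0 : ℝ) (0 : ℝ)).congr_of_eventuallyEq hev)
  have hinj : Injective ((D : EuclideanSpace ℝ (Fin d) →ₗ[ℝ] EuclideanSpace ℝ (Fin d)).restrict
      hmap) := by
    intro ξ ξ' h
    have h3 : D ξ = D ξ' := congrArg Subtype.val h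
    refine Subtype.ext ?_
    rw [← fderiv_transition_comp he he' hp hp' (ξ : EuclideanSpace ℝ (Fin d)), ← hD, h3,
      fderiv_transition_comp he he' hp hp']
  have h3 := LinearMap.finrank_le_finrank_of_injective hinj
  omega

end LocalCoordinates

/-! ### Transverse coordinates on `V × W` -/

section NormalCoordinates

variable {V W : Type*} [NormedAddCommGroup V] [NormedSpace ℝ V] [NormedAddCommGroup W]
  [NormedSpace ℝ W]

/-- By the inverse function theorem `z ↦ (z.1, Φ z)` is injective near `0`, and it takes the same
value at `z` and at `(z.1, 0)` when `Φ z = 0`. -/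
theorem eventually_snd_eq_zero_of_apply_eq_zero [CompleteSpace V] [CompleteSpace W] {F : Type*}
    [NormedAddCommGroup F] [NormedSpace ℝ F] {Φ : V × W → F} (hΦ : SmoothNear Φ 0)
    {L : W ≃L[ℝ] F}
    (hL : HasFDerivAt Φ ((L : W →L[ℝ] F).comp (ContinuousLinearMap.snd ℝ V W)) 0)
    (hV : ∀ᶠ v in 𝓝 (0 : V), Φ (v, 0) = 0) : ∀ᶠ z in 𝓝 0, Φ z = 0 → z.2 = 0 := by
  obtain ⟨e, he0, he, -, -⟩ := SmoothNear.exists_openPartialHomeomorph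
    (f := fun z : V × W => (z.1, Φ z)) (f' := (ContinuousLinearEquiv.refl ℝ V).prodCongr L)
    ((contDiff_fst.smoothNear _).prodMk hΦ) (hasFDerivAt_fst.prodMk hL)
  have h1 : Tendsto (fun z : V × W => z.1) (𝓝 0) (𝓝 0) := continuous_fst.tendsto' 0 0 rfl
  have hsrc := e.open_source.mem_nhds he0
  filter_upwards [hsrc, h1.eventually (tendsto_mk_zero.eventually hsrc), h1.eventually hV]
    with z h2 h3 h4 h5
  have : z = (z.1, 0) := e.injOn h2 h3 (by rw [he, he, h4, h5])
  rw [this]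

/-- The joint derivative is block triangular with invertible diagonal blocks `L₁`, `L₂`; `D₁` may
still depend on `W`, so the inverse solves for the `W` component first. -/
theorem exists_hasFDerivAt_sumElim [FiniteDimensional ℝ V] [FiniteDimensional ℝ W] {ι κ : Type*}
    [Fintype ι] [Fintype κ] {Φ₁ : V × W → ι → ℝ} {Φ₂ : V × W → κ → ℝ}
    {L₁ : V ≃L[ℝ] (ι → ℝ)} {L₂ : W ≃L[ℝ] (κ → ℝ)} {D₁ : V × W →L[ℝ] (ι → ℝ)}
    (h₁ : HasFDerivAt Φ₁ D₁ 0) (hD : ∀ v, D₁ (v, 0) = L₁ v)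
    (h₂ : HasFDerivAt Φ₂ ((L₂ : W →L[ℝ] (κ → ℝ)).comp (ContinuousLinearMap.snd ℝ V W)) 0) :
    ∃ D : (V × W) ≃L[ℝ] (ι ⊕ κ → ℝ),
      HasFDerivAt (fun z => Sum.elim (Φ₁ z) (Φ₂ z)) (D : V × W →L[ℝ] (ι ⊕ κ → ℝ)) 0 := by
  have hsplit : ∀ z, D₁ z = L₁ z.1 + D₁ (0, z.2) := fun z => by
    rw [← hD, ← map_add]
    simp
  let D : (V × W) ≃ₗ[ℝ] (ι ⊕ κ → ℝ) :=
    { toFun := fun z => Sum.elim (D₁ z) (L₂ z.2)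
      map_add' := fun z z' => by ext (i | i) <;> simp
      map_smul' := fun t z => by ext (i | i) <;> simp
      invFun := fun y =>
        (L₁.symm (fun i => y (Sum.inl i) - D₁ (0, L₂.symm fun j => y (Sum.inr j)) i),
          L₂.symm fun j => y (Sum.inr j))
      left_inv := fun z => by
        refine Prod.ext ?_ (L₂.symm_apply_apply z.2)
        change L₁.symm (fun i => D₁ z i - D₁ (0, L₂.symm (L₂ z.2)) i) = z.1
        rw [L₂.symm_apply_apply, hsplit]
        simp
      right_inv := fun y => by
        ext (i | i)
        · change D₁ (_, _) i = _
          rw [hsplit]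
          simp
        · simp }
  refine ⟨D.toContinuousLinearEquiv, hasFDerivAt_pi'.2 fun i => ?_⟩
  rcases i with i | i
  · exact hasFDerivAt_pi'.1 h₁ i
  · exact hasFDerivAt_pi'.1 h₂ i

end NormalCoordinates

/-! ### Adapted charts: transferring the normal form to the pair `(Ω, M)` -/

/-- Charts of `M` and `Ω` in which `emb : M → Ω` is the inclusion of a linear subspace. -/
structure AdaptedChart (m d : ℕ) {M Ω : Type*}
    [TopologicalSpace M] [ChartedSpace (EuclideanSpace ℝ (Fin m)) M]
    [TopologicalSpace Ω] [ChartedSpace (EuclideanSpace ℝ (Fin d)) Ω]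
    (emb : M → Ω) (p₀ : M) (W : Type*) [NormedAddCommGroup W] [NormedSpace ℝ W] where
  dom : OpenPartialHomeomorph M (EuclideanSpace ℝ (Fin m))
  cod : OpenPartialHomeomorph Ω (EuclideanSpace ℝ (Fin d))
  equiv : (EuclideanSpace ℝ (Fin m) × W) ≃L[ℝ] EuclideanSpace ℝ (Fin d)
  dom_mem : dom ∈ IsManifold.maximalAtlas (𝓡 m) ∞ M
  cod_mem : cod ∈ IsManifold.maximalAtlas (𝓡 d) ∞ Ω
  mem_dom : p₀ ∈ dom.source
  mapsTo : MapsTo emb dom.source cod.source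
  cod_emb : ∀ q ∈ dom.source, cod (emb q) = equiv (dom q, 0)

namespace AdaptedChart

variable {m d : ℕ} {M Ω : Type*}
  [TopologicalSpace M] [ChartedSpace (EuclideanSpace ℝ (Fin m)) M]
  [TopologicalSpace Ω] [ChartedSpace (EuclideanSpace ℝ (Fin d)) Ω]
  {emb : M → Ω} {p₀ : M}

theorem exists_of_isSmoothEmbedding
    (hemb : Manifold.IsSmoothEmbedding (𝓡 m) (𝓡 d) ∞ emb) (p₀ : M) :
    ∃ (W : Type) (_ : NormedAddCommGroup W) (_ : NormedSpace ℝ W),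
      Nonempty (AdaptedChart m d emb p₀ W) := by
  obtain ⟨W, i1, i2, h⟩ := hemb.isImmersion.isImmersionAt p₀
  refine ⟨W, i1, i2, ⟨h.domChart, h.codChart, h.equiv, h.domChart_mem_maximalAtlas,
    h.codChart_mem_maximalAtlas, h.mem_domChart_source, h.mapsto_domChart_source_codChart_source,
    fun q hq => ?_⟩⟩
  have hq' : h.domChart q ∈ (h.domChart.extend (𝓡 m)).target := by
    simpa using h.domChart.map_source hq
  simpa [h.domChart.left_inv hq] using h.writtenInCharts hq'

variable {W : Type*} [NormedAddCommGroup W] [NormedSpace ℝ W] (A : AdaptedChart m d emb p₀ W)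

/-- The chart of `Ω` with values in the product, centred at the base point. -/
noncomputable def centered : OpenPartialHomeomorph Ω (EuclideanSpace ℝ (Fin m) × W) :=
  A.cod.transHomeomorph (A.equiv.symm.toHomeomorph.trans
    (Homeomorph.addRight (-(A.dom p₀, (0 : W)))))

theorem centered_apply (u : Ω) : A.centered u = A.equiv.symm (A.cod u) - (A.dom p₀, 0) :=
  (sub_eq_add_neg _ _).symm

theorem centered_symm_apply (z : EuclideanSpace ℝ (Fin m) × W) :
    A.centered.symm z = A.cod.symm (A.equiv (z + (A.dom p₀, 0))) := by
  change A.cod.symm (A.equiv (z + - -(A.dom p₀, (0 : W)))) = _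
  rw [neg_neg]

theorem centered_emb {q : M} (hq : q ∈ A.dom.source) :
    A.centered (emb q) = (A.dom q - A.dom p₀, 0) := by
  rw [centered_apply, A.cod_emb q hq]
  simp

theorem centered_base : A.centered (emb p₀) = 0 := by
  simp [A.centered_emb A.mem_dom]

theorem mem_centered_source : emb p₀ ∈ A.centered.source := A.mapsTo A.mem_dom

theorem centered_symm_zero : A.centered.symm 0 = emb p₀ := by
  rw [← A.centered_base, A.centered.left_inv A.mem_centered_source]

theorem tendsto_centered : Tendsto A.centered (𝓝 (emb p₀)) (𝓝 0) := by
  have := (A.centered.continuousAt A.mem_centered_source).tendsto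
  rwa [A.centered_base] at this

theorem tendsto_centered_symm : Tendsto A.centered.symm (𝓝 0) (𝓝 (emb p₀)) := by
  have := A.centered.tendsto_symm_nhds A.mem_centered_source
  rwa [A.centered_base] at this

theorem eventually_mem_centered_target : ∀ᶠ z in 𝓝 0, z ∈ A.centered.target := by
  have := A.centered.map_source A.mem_centered_source
  rw [A.centered_base] at this
  exact A.centered.open_target.mem_nhds this

theorem tendsto_add_base :
    Tendsto (fun v => v + A.dom p₀) (𝓝 0) (𝓝 (A.dom p₀)) :=
  (by fun_prop : Continuous fun v => v + A.dom p₀).tendsto' _ _ (zero_add _)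

theorem eventually_centered_symm_mk : ∀ᶠ v in 𝓝 (0 : EuclideanSpace ℝ (Fin m)),
    A.centered.symm (v, 0) = emb (A.dom.symm (v + A.dom p₀)) := by
  filter_upwards [A.tendsto_add_base.eventually
    (A.dom.open_target.mem_nhds (A.dom.map_source A.mem_dom))] with v hv
  have hq := A.dom.map_target hv
  have h1 : A.centered (emb (A.dom.symm (v + A.dom p₀))) = (v, 0) := by
    rw [A.centered_emb hq, A.dom.right_inv hv, add_sub_cancel_right]
  rw [← h1, A.centered.left_inv (A.mapsTo hq)]

/-- The topology of `M` is induced from `Ω`, so no distant part of `M` returns close to the base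
point; an immersion alone would not give this. -/
theorem eventually_of_isEmbedding {M Ω : Type*} [TopologicalSpace M] [TopologicalSpace Ω]
    {emb : M → Ω} (hemb : IsEmbedding emb) {p₀ : M} {s : Set M}
    (hs : s ∈ 𝓝 p₀) : ∀ᶠ u in 𝓝 (emb p₀), ∀ q, emb q = u → q ∈ s := by
  rw [hemb.isInducing.nhds_eq_comap] at hs
  exact eventually_comap.1 (show ∀ᶠ q in comap emb (𝓝 (emb p₀)), q ∈ s from hs)

theorem smoothNear_comp_centered_symm {F : Ω → ℝ} (hF : ContMDiff (𝓡 d) 𝓘(ℝ, ℝ) ∞ F) :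
    SmoothNear (fun z => F (A.centered.symm z)) 0 := by
  simp only [centered_symm_apply]
  refine SmoothNear.comp_of_eq (f := fun y => F (A.cod.symm y))
    (hF.smoothNear_comp_chart_symm A.cod_mem A.mem_centered_source)
    ((A.equiv.contDiff.comp (contDiff_id.add contDiff_const)).smoothNear _) ?_
  simp [A.cod_emb p₀ A.mem_dom]

theorem smoothNear_conj {τ : Ω → Ω} (hτ : ContMDiff (𝓡 d) (𝓡 d) ∞ τ)
    (hfix : τ (emb p₀) = emb p₀) :
    SmoothNear (fun z => A.centered (τ (A.centered.symm z))) 0 := by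
  simp only [centered_symm_apply, centered_apply]
  have h := SmoothNear.comp_of_eq (x := (0 : EuclideanSpace ℝ (Fin m) × W))
    (g := fun z => A.equiv (z + (A.dom p₀, 0)))
    (hτ.smoothNear_chart_comp_chart_symm A.cod_mem A.cod_mem A.mem_centered_source
      (by rw [hfix]; exact A.mem_centered_source))
    ((A.equiv.contDiff.comp (contDiff_id.add contDiff_const)).smoothNear _)
    (by simp [A.cod_emb _ A.mem_dom])
  exact h.mono fun z hz => (A.equiv.symm.contDiff.contDiffAt.comp z hz).sub contDiffAt_const

/-- The hypotheses of the local normal form hold in an adapted chart. -/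
theorem exists_normal_form [IsManifold (𝓡 m) ∞ M] [IsManifold (𝓡 d) ∞ Ω]
    [FiniteDimensional ℝ W] (hemb : IsEmbedding emb)
    {τ : Ω → Ω} (hτ : ContMDiff (𝓡 d) (𝓡 d) ∞ τ) (hττ : Involutive τ)
    (hτM : MapsTo τ (range emb) (range emb)) (hfix : τ (emb p₀) = emb p₀)
    {F : Ω → ℝ} (hF : IsEmbeddedEquivariantMorse m d emb τ F)
    (hcrit : IsCriticalPoint m (F ∘ emb) p₀) :
    ∃ (r p q s : ℕ) (hs : 0 < s), ∃ a ≤ r, ∃ b ≤ p,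
      ∃ (Φ₁ : EuclideanSpace ℝ (Fin m) × W → Fin r ⊕ Fin p → ℝ)
        (Φ₂ : EuclideanSpace ℝ (Fin m) × W → Fin q ⊕ Fin s → ℝ)
        (L₁ : EuclideanSpace ℝ (Fin m) ≃L[ℝ] (Fin r ⊕ Fin p → ℝ))
        (L₂ : W ≃L[ℝ] (Fin q ⊕ Fin s → ℝ))
        (D₁ : EuclideanSpace ℝ (Fin m) × W →L[ℝ] (Fin r ⊕ Fin p → ℝ)),
        SmoothNear Φ₁ 0 ∧ SmoothNear Φ₂ 0 ∧ Φ₁ 0 = 0 ∧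
        HasFDerivAt Φ₁ D₁ 0 ∧ (∀ v, D₁ (v, 0) = L₁ v) ∧
        HasFDerivAt Φ₂ ((L₂ : W →L[ℝ] (Fin q ⊕ Fin s → ℝ)).comp
          (ContinuousLinearMap.snd ℝ (EuclideanSpace ℝ (Fin m)) W)) 0 ∧
        (∀ᶠ v in 𝓝 (0 : EuclideanSpace ℝ (Fin m)), Φ₂ (v, 0) = 0) ∧
        (∀ᶠ u in 𝓝 (emb p₀),
          (∀ i, Φ₁ (A.centered (τ u)) (Sum.inl i) = -Φ₁ (A.centered u) (Sum.inl i)) ∧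
          (∀ i, Φ₁ (A.centered (τ u)) (Sum.inr i) = Φ₁ (A.centered u) (Sum.inr i)) ∧
          (∀ i, Φ₂ (A.centered (τ u)) (Sum.inl i) = -Φ₂ (A.centered u) (Sum.inl i)) ∧
          (∀ i, Φ₂ (A.centered (τ u)) (Sum.inr i) = Φ₂ (A.centered u) (Sum.inr i))) ∧
        ∀ᶠ u in 𝓝 (emb p₀), F u = F (emb p₀)
          + (∑ i : Fin r, if (i : ℕ) < a then -(Φ₁ (A.centered u) (Sum.inl i)) ^ 2
              else (Φ₁ (A.centered u) (Sum.inl i)) ^ 2)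
          + (∑ i : Fin p, if (i : ℕ) < b then -(Φ₁ (A.centered u) (Sum.inr i)) ^ 2
              else (Φ₁ (A.centered u) (Sum.inr i)) ^ 2)
          + Φ₂ (A.centered u) (Sum.inr ⟨0, hs⟩) := by
  have hτc : Tendsto τ (𝓝 (emb p₀)) (𝓝 (emb p₀)) := by
    have := hτ.continuous.tendsto (emb p₀)
    rwa [hfix] at this
  have hτρ : Tendsto (fun z => τ (A.centered.symm z)) (𝓝 0) (𝓝 (emb p₀)) :=
    hτc.comp A.tendsto_centered_symm
  have hsrc := A.centered.open_source.mem_nhds A.mem_centered_source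
  have hττ' : ∀ᶠ z in 𝓝 0, A.centered (τ (A.centered.symm
      (A.centered (τ (A.centered.symm z))))) = z := by
    filter_upwards [A.eventually_mem_centered_target,
      hτρ.eventually_mem hsrc] with z h1 h2
    rw [A.centered.left_inv h2, hττ, A.centered.right_inv h1]
  -- `τ` sends a point of `M` to a point of `M` close to `emb p₀`, which therefore comes from the
  -- domain of the adapted chart.
  have hτV : ∀ᶠ v in 𝓝 (0 : EuclideanSpace ℝ (Fin m)),
      (A.centered (τ (A.centered.symm (v, 0)))).2 = 0 := by
    filter_upwards [A.eventually_centered_symm_mk,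
      (hτρ.comp tendsto_mk_zero).eventually
        (eventually_of_isEmbedding hemb (A.dom.open_source.mem_nhds A.mem_dom))] with v h1 h2
    obtain ⟨q, hq⟩ := hτM (mem_range_self (A.dom.symm (v + A.dom p₀)))
    rw [← h1] at hq
    rw [← hq, A.centered_emb (h2 q hq)]
  have hFs := hF.morse.smooth
  have hfs := hF.morse_restrict.smooth
  have hFG : (fun v : EuclideanSpace ℝ (Fin m) => F (A.centered.symm (v, 0))) =ᶠ[𝓝 0]
      fun v => (fun y => (F ∘ emb) (A.dom.symm y)) (v + A.dom p₀) :=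
    A.eventually_centered_symm_mk.mono fun v hv => congrArg F hv
  have hc0 := (isCriticalPoint_iff hfs p₀).1 hcrit
  have hcrit' : fderiv ℝ (fun v : EuclideanSpace ℝ (Fin m) => F (A.centered.symm (v, 0))) 0 = 0 := by
    rw [hFG.fderiv_eq, fderiv_comp_add_right (f := fun y => (F ∘ emb) (A.dom.symm y)), zero_add]
    exact fderiv_comp_chart_symm_eq_zero hfs A.dom_mem (IsManifold.chart_mem_maximalAtlas p₀)
      A.mem_dom (mem_chart_source _ p₀) hc0
  have hnd : ∀ u, (∀ v, fderiv ℝ (fderiv ℝ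
      (fun v : EuclideanSpace ℝ (Fin m) => F (A.centered.symm (v, 0)))) 0 u v = 0) → u = 0 := by
    intro u hu
    refine nondegenerate_comp_chart_symm hfs A.dom_mem (IsManifold.chart_mem_maximalAtlas p₀)
      A.mem_dom (mem_chart_source _ p₀) hc0 (nondegenerate_of_hessianMatrix_det_ne_zero hfs
        (hF.morse_restrict.nondegenerate p₀ hcrit)) u fun v => ?_
    rw [← hu v, hFG.fderiv.fderiv_eq]
    have h1 : fderiv ℝ (fun v => (fun y => (F ∘ emb) (A.dom.symm y)) (v + A.dom p₀)) =
        fun v => fderiv ℝ (fun y => (F ∘ emb) (A.dom.symm y)) (v + A.dom p₀) :=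
      funext fun v => fderiv_comp_add_right (f := fun y => (F ∘ emb) (A.dom.symm y)) _
    rw [h1, fderiv_comp_add_right, zero_add]
  have hdG : fderiv ℝ (fun z => F (A.centered.symm z)) 0 ≠ 0 := by
    intro h
    refine hF.not_critical p₀ ((isCriticalPoint_iff hFs _).2 ?_)
    refine fderiv_comp_chart_symm_eq_zero hFs (IsManifold.chart_mem_maximalAtlas _) A.cod_mem
      (mem_chart_source _ _) A.mem_centered_source ?_
    have hG := (A.smoothNear_comp_centered_symm hFs).differentiableAt.hasFDerivAt
    rw [h] at hG
    have hl : HasFDerivAt (fun y => A.equiv.symm y - (A.dom p₀, (0 : W)))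
        (A.equiv.symm : EuclideanSpace ℝ (Fin d) →L[ℝ] _) (A.cod (emb p₀)) :=
      A.equiv.symm.hasFDerivAt.sub_const _
    have h2 := HasFDerivAt.comp (g := fun z => F (A.centered.symm z)) (A.cod (emb p₀))
      (by rw [← A.centered_apply, A.centered_base]; exact hG) hl
    rw [ContinuousLinearMap.zero_comp] at h2
    refine HasFDerivAt.fderiv (h2.congr_of_eventuallyEq (Eventually.of_forall fun y => ?_))
    simp [centered_symm_apply]
  obtain ⟨r, p, q, s, hs, a, ha, b, hb, Φ₁, Φ₂, L₁, L₂, D₁, h1, h2, h3, h4, h5, h6, h7, h8, h9⟩ :=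
    exists_local_normal_form (A.smoothNear_conj hτ hfix)
      (by rw [A.centered_symm_zero, hfix, A.centered_base]) hττ' hτV
      (A.smoothNear_comp_centered_symm hFs)
      (by
        filter_upwards [hτρ.eventually_mem hsrc] with z hz
        rw [A.centered.left_inv hz, hF.invariant]) hcrit' hnd hdG
  refine ⟨r, p, q, s, hs, a, ha, b, hb, Φ₁, Φ₂, L₁, L₂, D₁, h1, h2, h3, h4, h5, h6, h7, ?_, ?_⟩
  · filter_upwards [hsrc, A.tendsto_centered.eventually h8] with u hu h
    rwa [A.centered.left_inv hu] at h
  · filter_upwards [hsrc, A.tendsto_centered.eventually h9] with u hu h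
    rwa [A.centered.left_inv hu, A.centered_symm_zero] at h

/-- Near the base point, the image of `emb` is the zero set of the transverse coordinates. -/
theorem eventually_mem_range_iff [FiniteDimensional ℝ W] (hemb : IsEmbedding emb) {G : Type*}
    [NormedAddCommGroup G] [NormedSpace ℝ G]
    {Φ : EuclideanSpace ℝ (Fin m) × W → G} (hΦ : SmoothNear Φ 0) {L : W ≃L[ℝ] G}
    (hL : HasFDerivAt Φ ((L : W →L[ℝ] G).comp
      (ContinuousLinearMap.snd ℝ (EuclideanSpace ℝ (Fin m)) W)) 0)
    (hV : ∀ᶠ v in 𝓝 (0 : EuclideanSpace ℝ (Fin m)), Φ (v, 0) = 0) :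
    ∀ᶠ u in 𝓝 (emb p₀), u ∈ range emb ↔ Φ (A.centered u) = 0 := by
  have : CompleteSpace W := FiniteDimensional.complete ℝ W
  have h1 : ∀ᶠ q in 𝓝 p₀, Φ (A.dom q - A.dom p₀, 0) = 0 := by
    have : Tendsto (fun q => A.dom q - A.dom p₀) (𝓝 p₀) (𝓝 0) := by
      simpa using (A.dom.continuousAt A.mem_dom).tendsto.sub_const (A.dom p₀)
    exact this.eventually hV
  have hfst : Tendsto (fun z : EuclideanSpace ℝ (Fin m) × W => z.1) (𝓝 0) (𝓝 0) :=
    continuous_fst.tendsto' 0 0 rfl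
  filter_upwards [eventually_of_isEmbedding hemb h1,
    eventually_of_isEmbedding hemb (A.dom.open_source.mem_nhds A.mem_dom),
    A.tendsto_centered.eventually (eventually_snd_eq_zero_of_apply_eq_zero hΦ hL hV),
    A.tendsto_centered.eventually (hfst.eventually A.eventually_centered_symm_mk),
    A.centered.open_source.mem_nhds A.mem_centered_source] with u h2 h3 h4 h5 h6
  constructor
  · rintro ⟨q, hq⟩
    rw [← hq, A.centered_emb (h3 q hq)]
    exact h2 q hq
  · intro h
    have h7 : A.centered u = ((A.centered u).1, 0) := Prod.ext rfl (h4 h)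
    rw [← h7, A.centered.left_inv h6] at h5
    exact ⟨_, h5.symm⟩

/-- Coordinates centred at the base point give local coordinates on `Ω`. -/
theorem exists_isLocalCoordinates_cod {ι : Type*} [Fintype ι]
    {Φ : EuclideanSpace ℝ (Fin m) × W → ι → ℝ} (hΦ : SmoothNear Φ 0)
    {D : (EuclideanSpace ℝ (Fin m) × W) ≃L[ℝ] (ι → ℝ)}
    (hD : HasFDerivAt Φ (D : EuclideanSpace ℝ (Fin m) × W →L[ℝ] (ι → ℝ)) 0) :
    ∃ N : Set Ω, IsOpen N ∧ emb p₀ ∈ N ∧ InjOn (fun u => Φ (A.centered u)) N ∧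
      ∀ U ⊆ N, IsOpen U → IsLocalCoordinates d U (fun i u => Φ (A.centered u) i) := by
  have h0 : A.equiv.symm (A.cod (emb p₀)) - (A.dom p₀, (0 : W)) = 0 := by
    rw [← A.centered_apply, A.centered_base]
  have hl : HasFDerivAt (fun y => A.equiv.symm y - (A.dom p₀, (0 : W)))
      (A.equiv.symm : EuclideanSpace ℝ (Fin d) →L[ℝ] _) (A.cod (emb p₀)) :=
    A.equiv.symm.hasFDerivAt.sub_const _
  have hc := HasFDerivAt.comp (g := Φ) (A.cod (emb p₀)) (by rw [h0]; exact hD) hl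
  obtain ⟨N, h1, h2, -, h3, h4⟩ := exists_isLocalCoordinates A.cod_mem A.mem_centered_source
    (Ψ := fun y => Φ (A.equiv.symm y - (A.dom p₀, 0))) (D := A.equiv.symm.trans D)
    (hΦ.comp_of_eq ((A.equiv.symm.contDiff.sub contDiff_const).smoothNear _) h0) hc
  simp only [← centered_apply] at h3 h4
  exact ⟨N, h1, h2, h3, h4⟩

/-- Coordinates centred at the base point give local coordinates on `M`. -/
theorem exists_isLocalCoordinates_dom {ι : Type*} [Fintype ι]
    {Φ : EuclideanSpace ℝ (Fin m) × W → ι → ℝ} (hΦ : SmoothNear Φ 0)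
    {L : EuclideanSpace ℝ (Fin m) ≃L[ℝ] (ι → ℝ)}
    {D : EuclideanSpace ℝ (Fin m) × W →L[ℝ] (ι → ℝ)} (hD : HasFDerivAt Φ D 0)
    (hDL : ∀ v, D (v, 0) = L v) :
    ∃ N : Set M, IsOpen N ∧ p₀ ∈ N ∧
      ∀ U ⊆ N, IsOpen U → IsLocalCoordinates m U (fun i q => Φ (A.centered (emb q)) i) := by
  have hL : HasFDerivAt (fun v => Φ (v, 0)) (L : EuclideanSpace ℝ (Fin m) →L[ℝ] (ι → ℝ)) 0 :=
    hD.comp_mk_zero.congr_fderiv (ContinuousLinearMap.ext hDL)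
  have hl : HasFDerivAt (fun y => y - A.dom p₀)
      (ContinuousLinearMap.id ℝ (EuclideanSpace ℝ (Fin m))) (A.dom p₀) :=
    (hasFDerivAt_id _).sub_const _
  have hc := HasFDerivAt.comp (g := fun v => Φ (v, 0)) (A.dom p₀) (by rw [sub_self]; exact hL) hl
  obtain ⟨N, h1, h2, h3, -, h4⟩ := exists_isLocalCoordinates A.dom_mem A.mem_dom
    (Ψ := fun y => Φ (y - A.dom p₀, 0)) (D := L)
    (hΦ.comp_mk_zero.comp_of_eq ((contDiff_id.sub contDiff_const).smoothNear _) (sub_self _)) hc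
  refine ⟨N, h1, h2, fun U hU hUo => ?_⟩
  obtain ⟨e, he, rfl, c, hc⟩ := h4 U hU hUo
  refine ⟨e, he, rfl, c, fun u hu i => ?_⟩
  rw [← hc u hu i]
  change Φ (A.centered (emb u)) i = Φ (A.dom u - A.dom p₀, 0) i
  rw [A.centered_emb (h3 (hU hu))]

end AdaptedChart

/-! ### The equivariant embedded Morse lemma -/

theorem mainTheorem7 (m k n r : ℕ) (hk : 0 < k)
    {Ω : Type*} [TopologicalSpace Ω] [T2Space Ω] [CompactSpace Ω]
    [ChartedSpace (EuclideanSpace ℝ (Fin (m + k))) Ω] [IsManifold (𝓡 (m + k)) ∞ Ω]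
    {M : Type*} [TopologicalSpace M] [T2Space M] [CompactSpace M]
    [ChartedSpace (EuclideanSpace ℝ (Fin m)) M] [IsManifold (𝓡 m) ∞ M]
    -- the submanifold `M ⊆ Ω` of dimension `m`
    (emb : M → Ω) (hemb : Manifold.IsSmoothEmbedding (𝓡 m) (𝓡 (m + k)) ∞ emb)
    -- the smooth involution `τ` of `Ω`, preserving `M`
    (τ : Ω → Ω) (hτ : ContMDiff (𝓡 (m + k)) (𝓡 (m + k)) ∞ τ) (hττ : Involutive τ)
    (hτM : MapsTo τ (range emb) (range emb))
    -- codimension of the fixed point set in `Ω`, and of its intersection with `M` in `M`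
    (hn : IsSubmanifoldOfCodim (m + k) n (fixedPoints τ))
    (hr : IsSubmanifoldOfCodim m r (emb ⁻¹' fixedPoints τ))
    (F : Ω → ℝ) (hF : IsEmbeddedEquivariantMorse m (m + k) emb τ F)
    (p₀ : M) (u₀ : Ω) (hu₀ : emb p₀ = u₀) (hfix : u₀ ∈ fixedPoints τ)
    (hcrit : IsCriticalPoint m (F ∘ emb) p₀) :
    r ≤ m ∧ r ≤ n ∧ ∃ (s : ℕ) (hs : 0 < s), (n - r) + s = k ∧
      ∃ a ≤ r, ∃ b ≤ m - r,
      ∃ (U : Set Ω) (x : Fin r → Ω → ℝ) (y : Fin (m - r) → Ω → ℝ)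
        (v : Fin (n - r) → Ω → ℝ) (w : Fin s → Ω → ℝ),
        -- local coordinates near `u₀`, centred at `u₀`
        u₀ ∈ U ∧ IsLocalCoordinates (m + k) U (Sum.elim (Sum.elim x y) (Sum.elim v w)) ∧
        (∀ i, x i u₀ = 0) ∧ (∀ i, y i u₀ = 0) ∧ (∀ i, v i u₀ = 0) ∧ (∀ i, w i u₀ = 0) ∧
        -- `τ` is linear
        MapsTo τ U U ∧
        (∀ u ∈ U, (∀ i, x i (τ u) = -x i u) ∧ (∀ i, y i (τ u) = y i u) ∧
          (∀ i, v i (τ u) = -v i u) ∧ (∀ i, w i (τ u) = w i u)) ∧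
        -- `M` is a coordinate subspace
        (∀ u ∈ U, u ∈ range emb ↔ (∀ i, v i u = 0) ∧ (∀ i, w i u = 0)) ∧
        -- the fixed point set is a coordinate subspace
        (∀ u ∈ U, u ∈ fixedPoints τ ↔ (∀ i, x i u = 0) ∧ (∀ i, v i u = 0)) ∧
        -- `F` in these coordinates
        (∀ u ∈ U, F u = F u₀
          + ∑ i : Fin r, (if (i : ℕ) < a then -(x i u) ^ 2 else (x i u) ^ 2)
          + ∑ i : Fin (m - r), (if (i : ℕ) < b then -(y i u) ^ 2 else (y i u) ^ 2)
          + w ⟨0, hs⟩ u) := by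
  subst hu₀
  obtain ⟨W, _, _, ⟨A⟩⟩ := AdaptedChart.exists_of_isSmoothEmbedding hemb p₀
  have hWfd : FiniteDimensional ℝ W :=
    FiniteDimensional.of_injective
      (A.equiv.toLinearEquiv.toLinearMap ∘ₗ LinearMap.inr ℝ (EuclideanSpace ℝ (Fin m)) W)
      (A.equiv.injective.comp (Prod.mk_right_injective 0))
  obtain ⟨r', p, q, s, hs, a, ha, b, hb, Φ₁, Φ₂, L₁, L₂, D₁, hΦ₁, hΦ₂, hΦ₁0, hD₁, hDL, hD₂, hΦ₂V,
    hequi, hform⟩ := A.exists_normal_form hemb.isEmbedding hτ hττ hτM hfix hF hcrit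
  have hrp : r' + p = m := by
    have := L₁.toLinearEquiv.finrank_eq
    simpa using this.symm
  have hqs : q + s = k := by
    have h1 := L₂.toLinearEquiv.finrank_eq
    have h2 := A.equiv.toLinearEquiv.finrank_eq
    rw [Module.finrank_prod, h1] at h2
    simpa using h2
  have hrange := A.eventually_mem_range_iff hemb.isEmbedding hΦ₂ hD₂ hΦ₂V
  obtain ⟨D, hD⟩ := exists_hasFDerivAt_sumElim hD₁ hDL hD₂
  have hΦ : SmoothNear (fun z => Sum.elim (Φ₁ z) (Φ₂ z)) 0 := by
    refine SmoothNear.pi (f := fun i z => Sum.elim (Φ₁ z) (Φ₂ z) i) fun i => ?_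
    rcases i with i | i
    · exact hΦ₁.mono fun z hz => contDiffAt_pi.1 hz i
    · exact hΦ₂.mono fun z hz => contDiffAt_pi.1 hz i
  obtain ⟨N, hNo, hpN, hNinj, hNcoord⟩ := A.exists_isLocalCoordinates_cod hΦ hD
  obtain ⟨O, hO, hOo, hpO⟩ := eventually_nhds_iff.1
    ((hNo.eventually_mem hpN).and (hrange.and (hequi.and hform)))
  -- the invariant neighbourhood
  let U : Set Ω := O ∩ τ ⁻¹' O
  have hUo : IsOpen U := hOo.inter (hOo.preimage hτ.continuous)
  have hpU : emb p₀ ∈ U := ⟨hpO, by rw [mem_preimage, hfix]; exact hpO⟩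
  have hτU : MapsTo τ U U := fun u hu => ⟨hu.2, by rw [mem_preimage, hττ]; exact hu.1⟩
  have hUN : U ⊆ N := fun u hu => (hO u hu.1).1
  have hUequi := fun u (hu : u ∈ U) => (hO u hu.1).2.2.1
  have hUfix : ∀ u ∈ U, u ∈ fixedPoints τ ↔ (∀ i, Φ₁ (A.centered u) (Sum.inl i) = 0) ∧
      ∀ i, Φ₂ (A.centered u) (Sum.inl i) = 0 := by
    intro u hu
    obtain ⟨h1, h2, h3, h4⟩ := hUequi u hu
    constructor
    · intro h
      rw [mem_fixedPoints, IsFixedPt] at h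
      rw [h] at h1 h3
      exact ⟨fun i => self_eq_neg.1 (h1 i), fun i => self_eq_neg.1 (h3 i)⟩
    · rintro ⟨h5, h6⟩
      -- `u` and `τ u` have equal coordinates once the sign-changing ones vanish, and the
      -- coordinates separate points of `N`.
      refine hNinj (hUN (hτU hu)) (hUN hu) ?_
      ext ((i | i) | (i | i))
      · simp [h1, h5]
      · simp [h2]
      · simp [h3, h6]
      · simp [h4]
  have hcoord := hNcoord U hUN hUo
  -- Near `u₀` the fixed point set is cut out both by `n` coordinates and by the `r' + q`
  -- sign-changing ones; compare in both directions.
  have hn' : n = r' + q := by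
    obtain ⟨U', hU', z', hz', J', hJ', hfix'⟩ := hn _ hfix
    let J : Finset ((Fin r' ⊕ Fin p) ⊕ (Fin q ⊕ Fin s)) :=
      (Finset.univ.map Embedding.inl).disjSum (Finset.univ.map Embedding.inl)
    have hJc : J.card = r' + q := by simp [J]
    have hJ : ∀ u ∈ U, u ∈ fixedPoints τ ↔
        ∀ i ∈ J, Sum.elim (Φ₁ (A.centered u)) (Φ₂ (A.centered u)) i = 0 := by
      intro u hu
      rw [hUfix u hu]
      simp [J]
    have h1 := card_le_card_of_isLocalCoordinates hcoord hz' hJ hfix' hfix hpU hU'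
    have h2 := card_le_card_of_isLocalCoordinates hz' hcoord hfix' hJ hfix hU' hpU
    omega
  have hr' : r = r' := by
    obtain ⟨U', hU', z', hz', J', hJ', hfix'⟩ := hr p₀ hfix
    obtain ⟨N', hN'o, hpN', hN'coord⟩ := A.exists_isLocalCoordinates_dom hΦ₁ hD₁ hDL
    have hcoord' := hN'coord (N' ∩ emb ⁻¹' U) inter_subset_left
      (hN'o.inter (hUo.preimage hemb.isEmbedding.continuous))
    let J : Finset (Fin r' ⊕ Fin p) := Finset.univ.map Embedding.inl
    have hJc : J.card = r' := by simp [J]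
    have hJ : ∀ x ∈ N' ∩ emb ⁻¹' U, x ∈ emb ⁻¹' fixedPoints τ ↔
        ∀ i ∈ J, Φ₁ (A.centered (emb x)) i = 0 := by
      intro x hx
      -- On `M` all transverse coordinates vanish, so only the `x` coordinates still cut out the
      -- fixed points.
      have h0 := (hO _ hx.2.1).2.1.1 (mem_range_self x)
      rw [mem_preimage, hUfix _ hx.2, h0]
      simp [J]
    have hpU' : p₀ ∈ N' ∩ emb ⁻¹' U := ⟨hpN', hpU⟩
    have h1 := card_le_card_of_isLocalCoordinates hcoord' hz' hJ hfix' hfix hpU' hU'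
    have h2 := card_le_card_of_isLocalCoordinates hz' hcoord' hfix' hJ hfix hU' hpU'
    omega
  subst hr'
  -- The subtractions `m - r` and `n - r` are exact, as `r + p = m` and `n = r + q`.
  obtain rfl : p = m - r := by omega
  obtain rfl : q = n - r := by omega
  have hΦ₂0 : Φ₂ 0 = 0 := hΦ₂V.self_of_nhds
  have hΦ₁u : Φ₁ (A.centered (emb p₀)) = 0 := by rw [A.centered_base, hΦ₁0]
  have hΦ₂u : Φ₂ (A.centered (emb p₀)) = 0 := by rw [A.centered_base, hΦ₂0]
  refine ⟨by omega, by omega, s, hs, hqs, a, ha, b, hb, U,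
    fun i u => Φ₁ (A.centered u) (Sum.inl i), fun i u => Φ₁ (A.centered u) (Sum.inr i),
    fun i u => Φ₂ (A.centered u) (Sum.inl i), fun i u => Φ₂ (A.centered u) (Sum.inr i),
    hpU, ?_, fun i => congrFun hΦ₁u _, fun i => congrFun hΦ₁u _,
    fun i => congrFun hΦ₂u _, fun i => congrFun hΦ₂u _, hτU, hUequi, ?_, hUfix,
    fun u hu => (hO u hu.1).2.2.2⟩
  · convert hcoord using 1
    ext ((i | i) | (i | i)) u <;> rfl
  · intro u hu
    rw [(hO u hu.1).2.1]
    constructor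
    · intro h
      simp [h]
    · rintro ⟨h1, h2⟩
      ext (i | i)
      · exact h1 i
      · exact h2 i
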